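/- **Notation.** Let $\mathbb{BC}=\{z_1+z_2\mathbf j : z_1,z_2\in\mathbb C(\mathbf i)\}$ be the commutative ring of bicomplex numbers ($\mathbf i\mathbf j=\mathbf j\mathbf i$, $\mathbf i^2=\mathbf j^2=-1$), with its Euclidean topology, $\mathbf k=\mathbf i\mathbf j$, $\mathbf e=\frac12(1+\mathbf i\mathbf j)$, $\mathbf e^\dagger=\frac12(1-\mathbf i\mathbf j)$. Every $Z\in\mathbb{BC}$ is uniquely $Z=\beta_1\mathbf e+\beta_2\mathbf e^\dagger$ with $\beta_1=z_1-\mathbf i z_2$, $\beta_2=z_1+\mathbf i z_2\in\mathbb C(\mathbf i)$. Put $Z^*=\bar z_1-\bar z_2\mathbf j$, and for a bicomplex matrix let $A^{*t}$ be the transpose of the entrywise $*$-conjugate. Let $\mathbb D^+=\{a+b\mathbf k : a,b\in\mathbb R,\ a\ge 0,\ a^2-b^2\ge 0\}$ and, for hyperbolic numbers, write $\alpha\lessdot\beta$ if $\beta-\alpha\in\mathbb D^+$. A matrix $A\in\mathbb{BC}^{n\times n}$ is hyperbolic positive if $A=A^{*t}$ and $c^{*t}Ac\in\mathbb D^+$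 for all $c\in\mathbb{BC}^n$; $A\le B$ means that $B-A$ is hyperbolic positive. Let $\mathbb K=\{\lambda\in\mathbb C:|\lambda|<1\}$ and $\Omega_{\mathbb K^2}=\{\beta_1\mathbf e+\beta_2\mathbf e^\dagger : \beta_1,\beta_2\in\mathbb K\}$. A function $F:\Omega_{\mathbb K^2}\to\mathbb{BC}$ is $\mathbb{BC}$-holomorphic if at each $Z_0\in\Omega_{\mathbb K^2}$ the quotient $(F(Z_0+H)-F(Z_0))/H$ has a limit as $H\to0$ through invertible $H$; a matrix function is $\mathbb{BC}$-holomorphic if all its entries are. A kernel $K(Z,W)\in\mathbb{BC}^{n\times n}$ on a set $\Omega$ is positive definite if $K(Z,W)=K(W,Z)^{*t}$ and $\sum_{\ell,j=1}^N c_j^{*t}K(Z_j,Z_\ell)c_\ell\in\mathbb D^+$ for all $N$, all $Z_1,\dots,Z_N\in\Omega$ and all $c_1,\dots,c_N\in\mathbb C(\mathbf i)^n$. The bicomplex Hardy space $\mathbf H^2(\Omega_{\mathbb K^2})$ consists of the functions $f(Z)=\sum_{k\ge0}f_kZ^k$ on $\Omega_{\mathbb K^2}$ with $f_k\in\mathbb{BC}$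 and $\sum_k f_kf_k^*$ convergent, with $\langle f,g\rangle=\sum_k f_kg_k^*$; on $(\mathbf H^2)^m$ the inner product is the sum of those of the components. A $\mathbb{BC}$-inner product on a $\mathbb{BC}$-module is a $\mathbb{BC}$-valued map, additive in each variable, with $\langle\mu x,y\rangle=\mu\langle x,y\rangle$, $\langle x,y\rangle=\langle y,x\rangle^*$, $\langle x,x\rangle\in\mathbb D^+$ and $\langle x,x\rangle=0$ iff $x=0$. If $\langle x,x\rangle=\nu\mathbf e+\mu\mathbf e^\dagger$, put $\|x\|_{\mathbb D}=\sqrt\nu\,\mathbf e+\sqrt\mu\,\mathbf e^\dagger$ and $\|x\|=\sqrt{(\nu+\mu)/2}$; the module is a $\mathbb{BC}$-Hilbert module if it is complete for $\|\cdot\|$. The module $\mathbb{BC}^n$ carries $\langle Z,W\rangle=\sum_i Z_iW_i^*$, and direct sums carry the sum of the inner products. A $\mathbb{BC}$-linear operator $T$ is $\mathbb D$-bounded if $\|Tx\|_{\mathbb D}\lessdot\Lambda\|x\|_{\mathbb D}$ for some $\Lambda\in\mathbb D^+$ and all $x$, and coisometric if it is $\mathbb D$-bounded and $TT^\sharp=I$,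 where $\langle Tx,y\rangle=\langle x,T^\sharp y\rangle$. **Theorem.** Let $s$ be a $\mathbb{BC}^{n\times m}$-valued $\mathbb{BC}$-holomorphic function on $\Omega_{\mathbb K^2}$. Then the following are equivalent. 1. There are classical Schur functions $s_1,s_2$ (that is, $\mathbb C^{n\times m}$-valued functions, holomorphic in $\mathbb K$, with Euclidean operator norm at most $1$ at every point of $\mathbb K$) such that $s(Z)=s_1(\beta_1)\mathbf e+s_2(\beta_2)\mathbf e^\dagger$ for all $Z=\beta_1\mathbf e+\beta_2\mathbf e^\dagger\in\Omega_{\mathbb K^2}$. 2. $s(Z)s(Z)^{*t}\le I_n$ for all $Z\in\Omega_{\mathbb K^2}$. 3. The kernel $\dfrac{I_n-s(Z)s(W)^{*t}}{1-ZW^*}$ is positive definite in $\Omega_{\mathbb K^2}$. 4. Multiplication by $s$ is a $\mathbb D$-contraction from $(\mathbf H^2(\Omega_{\mathbb K^2}))^m$ into $(\mathbf H^2(\Omega_{\mathbb K^2}))^n$: for every $f\in(\mathbf H^2(\Omega_{\mathbb K^2}))^m$ one has $sf\in(\mathbf H^2(\Omega_{\mathbb K^2}))^n$ and $\langle sf,sf\rangle\lessdot\langle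 f,f\rangle$. 5. There are a $\mathbb{BC}$-Hilbert module $\mathcal H$ and $\mathbb{BC}$-linear operators $A,B,C,D$ such that $$\begin{pmatrix}A&B\\ C&D\end{pmatrix}:\mathcal H\oplus\mathbb{BC}^m\to\mathcal H\oplus\mathbb{BC}^n$$ is coisometric and, for all $Z\in\Omega_{\mathbb K^2}$, $I_{\mathcal H}-ZA$ is invertible and $s(Z)=D+ZC(I_{\mathcal H}-ZA)^{-1}B$. -/

import Mathlib

universe u

noncomputable section

/-- Bicomplex numbers `z₁ + z₂ 𝐣` with `z₁, z₂ ∈ ℂ(𝐢)`, `𝐢 𝐣 = 𝐣 𝐢`, `𝐢² = 𝐣² = -1`. -/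
@[ext]
structure BC where
  z₁ : ℂ
  z₂ : ℂ

namespace BC

instance : Zero BC := ⟨⟨0, 0⟩⟩
instance : One BC := ⟨⟨1, 0⟩⟩
instance : Add BC := ⟨fun Z W => ⟨Z.z₁ + W.z₁, Z.z₂ + W.z₂⟩⟩
instance : Neg BC := ⟨fun Z => ⟨-Z.z₁, -Z.z₂⟩⟩
instance : Sub BC := ⟨fun Z W => ⟨Z.z₁ - W.z₁, Z.z₂ - W.z₂⟩⟩
instance : Mul BC := ⟨fun Z W => ⟨Z.z₁ * W.z₁ - Z.z₂ * W.z₂, Z.z₁ * W.z₂ + Z.z₂ * W.z₁⟩⟩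

@[simp] theorem zero_z₁ : (0 : BC).z₁ = 0 := rfl
@[simp] theorem zero_z₂ : (0 : BC).z₂ = 0 := rfl
@[simp] theorem one_z₁ : (1 : BC).z₁ = 1 := rfl
@[simp] theorem one_z₂ : (1 : BC).z₂ = 0 := rfl
@[simp] theorem add_z₁ (Z W : BC) : (Z + W).z₁ = Z.z₁ + W.z₁ := rfl
@[simp] theorem add_z₂ (Z W : BC) : (Z + W).z₂ = Z.z₂ + W.z₂ := rfl
@[simp] theorem neg_z₁ (Z : BC) : (-Z).z₁ = -Z.z₁ := rfl
@[simp] theorem neg_z₂ (Z : BC) : (-Z).z₂ = -Z.z₂ := rfl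
@[simp] theorem sub_z₁ (Z W : BC) : (Z - W).z₁ = Z.z₁ - W.z₁ := rfl
@[simp] theorem sub_z₂ (Z W : BC) : (Z - W).z₂ = Z.z₂ - W.z₂ := rfl
@[simp] theorem mul_z₁ (Z W : BC) : (Z * W).z₁ = Z.z₁ * W.z₁ - Z.z₂ * W.z₂ := rfl
@[simp] theorem mul_z₂ (Z W : BC) : (Z * W).z₂ = Z.z₁ * W.z₂ + Z.z₂ * W.z₁ := rfl

instance : CommRing BC where
  add_assoc a b c := by ext <;> simp [add_assoc]
  zero_add a := by ext <;> simp
  add_zero a := by ext <;> simp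
  add_comm a b := by ext <;> simp [add_comm]
  neg_add_cancel a := by ext <;> simp
  sub_eq_add_neg a b := by ext <;> simp [sub_eq_add_neg]
  mul_assoc a b c := by ext <;> simp <;> ring
  one_mul a := by ext <;> simp
  mul_one a := by ext <;> simp
  left_distrib a b c := by ext <;> simp <;> ring
  right_distrib a b c := by ext <;> simp <;> ring
  mul_comm a b := by ext <;> simp <;> ring
  zero_mul a := by ext <;> simp
  mul_zero a := by ext <;> simp
  nsmul := nsmulRec
  zsmul := zsmulRec

/-- The `∗`-conjugation `(z₁ + z₂ 𝐣)^∗ = z̄₁ - z̄₂ 𝐣`; for a bicomplex matrix `A`, the matrix `Aᴴ`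
is therefore `A^{∗t}`. -/
instance : StarRing BC where
  star Z := ⟨star Z.z₁, -star Z.z₂⟩
  star_involutive Z := by ext <;> simp
  star_mul Z W := by
    ext
    · change star (_ - _) = star W.z₁ * star Z.z₁ - (-star W.z₂) * (-star Z.z₂)
      simp only [star_sub, star_mul]; ring
    · change -star (_ + _) = star W.z₁ * (-star Z.z₂) + (-star W.z₂) * star Z.z₁
      simp only [star_add, star_mul]; ring
  star_add Z W := by
    ext
    · exact star_add _ _
    · change -star (_ + _) = -star Z.z₂ + -star W.z₂
      simp only [star_add]; ring

@[simp] theorem star_z₁ (Z : BC) : (star Z).z₁ = star Z.z₁ := rfl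
@[simp] theorem star_z₂ (Z : BC) : (star Z).z₂ = -star Z.z₂ := rfl

/-- The Euclidean topology of `BC ≅ ℂ × ℂ`. -/
instance : TopologicalSpace BC := TopologicalSpace.induced (fun Z => (Z.z₁, Z.z₂)) inferInstance

/-- The inclusion `ℂ(𝐢) ⊂ BC`. -/
def ofComplex (z : ℂ) : BC := ⟨z, 0⟩

/-- The idempotent `𝐞 = (1 + 𝐢𝐣) / 2`. -/
def e : BC := ⟨1 / 2, Complex.I / 2⟩

/-- The idempotent `𝐞† = (1 - 𝐢𝐣) / 2`. -/
def eDag : BC := ⟨1 / 2, -(Complex.I / 2)⟩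

/-- First idempotent coordinate: `Z = β₁ 𝐞 + β₂ 𝐞†`. -/
def β₁ (Z : BC) : ℂ := Z.z₁ - Complex.I * Z.z₂

/-- Second idempotent coordinate: `Z = β₁ 𝐞 + β₂ 𝐞†`. -/
def β₂ (Z : BC) : ℂ := Z.z₁ + Complex.I * Z.z₂

theorem eq_idempotent (Z : BC) : Z = ofComplex Z.β₁ * e + ofComplex Z.β₂ * eDag := by
  ext
  · simp [ofComplex, e, eDag, β₁, β₂]; ring
  · simp only [ofComplex, e, eDag, β₁, β₂, add_z₂, mul_z₂]
    linear_combination Z.z₂ * Complex.I_sq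

theorem ext_β {Z W : BC} (h₁ : Z.β₁ = W.β₁) (h₂ : Z.β₂ = W.β₂) : Z = W := by
  rw [eq_idempotent Z, eq_idempotent W, h₁, h₂]

@[simp] theorem β₁_idempotent (a b : ℂ) : (ofComplex a * e + ofComplex b * eDag).β₁ = a := by
  simp only [ofComplex, e, eDag, β₁, add_z₁, add_z₂, mul_z₁, mul_z₂]
  linear_combination (-(a - b) / 2) * Complex.I_sq

@[simp] theorem β₂_idempotent (a b : ℂ) : (ofComplex a * e + ofComplex b * eDag).β₂ = b := by
  simp only [ofComplex, e, eDag, β₂, add_z₁, add_z₂, mul_z₁, mul_z₂]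
  linear_combination ((a - b) / 2) * Complex.I_sq

@[simp] theorem β₁_zero : (0 : BC).β₁ = 0 := by simp [β₁]
@[simp] theorem β₂_zero : (0 : BC).β₂ = 0 := by simp [β₂]
@[simp] theorem β₁_one : (1 : BC).β₁ = 1 := by simp [β₁]
@[simp] theorem β₂_one : (1 : BC).β₂ = 1 := by simp [β₂]
@[simp] theorem β₁_add (Z W : BC) : (Z + W).β₁ = Z.β₁ + W.β₁ := by simp [β₁]; ring
@[simp] theorem β₂_add (Z W : BC) : (Z + W).β₂ = Z.β₂ + W.β₂ := by simp [β₂]; ring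
@[simp] theorem β₁_sub (Z W : BC) : (Z - W).β₁ = Z.β₁ - W.β₁ := by simp [β₁]; ring
@[simp] theorem β₂_sub (Z W : BC) : (Z - W).β₂ = Z.β₂ - W.β₂ := by simp [β₂]; ring
@[simp] theorem β₁_mul (Z W : BC) : (Z * W).β₁ = Z.β₁ * W.β₁ := by
  simp only [β₁, mul_z₁, mul_z₂]; linear_combination (-Z.z₂ * W.z₂) * Complex.I_sq
@[simp] theorem β₂_mul (Z W : BC) : (Z * W).β₂ = Z.β₂ * W.β₂ := by
  simp only [β₂, mul_z₁, mul_z₂]; linear_combination (-Z.z₂ * W.z₂) * Complex.I_sq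
@[simp] theorem β₁_star (Z : BC) : (star Z).β₁ = star Z.β₁ := by simp [β₁]
@[simp] theorem β₂_star (Z : BC) : (star Z).β₂ = star Z.β₂ := by simp [β₂]

/-- The set `𝔻⁺` of positive hyperbolic numbers `a + b 𝐤`, `𝐤 = 𝐢𝐣`, with `a ≥ 0` and
`a² - b² ≥ 0`. -/
def hypPos : Set BC :=
  {Z | ∃ a b : ℝ, Z = ⟨(a : ℂ), (b : ℂ) * Complex.I⟩ ∧ 0 ≤ a ^ 2 - b ^ 2 ∧ 0 ≤ a}

/-- The partial order of hyperbolic numbers: `α ⋖ β` when `β - α ∈ 𝔻⁺`. -/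
def hypLE (α β : BC) : Prop := β - α ∈ hypPos

theorem mem_hypPos_iff (Z : BC) :
    Z ∈ hypPos ↔ ∃ ν μ : ℝ, Z.β₁ = ν ∧ Z.β₂ = μ ∧ 0 ≤ ν ∧ 0 ≤ μ := by
  constructor
  · rintro ⟨a, b, rfl, h, ha⟩
    have hb := abs_le.1 (abs_le_of_sq_le_sq (sub_nonneg.1 h) ha)
    refine ⟨a + b, a - b, ?_, ?_, by linarith [hb.1], by linarith [hb.2]⟩
    · simp only [β₁]; push_cast; linear_combination (-(b : ℂ)) * Complex.I_sq
    · simp only [β₂]; push_cast; linear_combination (b : ℂ) * Complex.I_sq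
  · rintro ⟨ν, μ, h₁, h₂, hν, hμ⟩
    refine ⟨(ν + μ) / 2, (ν - μ) / 2, ext_β ?_ ?_, by nlinarith [mul_nonneg hν hμ], by linarith⟩
    · rw [h₁]; simp only [β₁]; push_cast
      linear_combination (((ν : ℂ) - μ) / 2) * Complex.I_sq
    · rw [h₂]; simp only [β₂]; push_cast
      linear_combination (-(((ν : ℂ) - μ) / 2)) * Complex.I_sq

theorem zero_mem_hypPos : (0 : BC) ∈ hypPos := (mem_hypPos_iff 0).2 ⟨0, 0, by simp⟩

theorem add_mem_hypPos {Z W : BC} (hZ : Z ∈ hypPos) (hW : W ∈ hypPos) : Z + W ∈ hypPos := by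
  obtain ⟨a, b, h₁, h₂, ha, hb⟩ := (mem_hypPos_iff Z).1 hZ
  obtain ⟨c, d, h₃, h₄, hc, hd⟩ := (mem_hypPos_iff W).1 hW
  exact (mem_hypPos_iff _).2 ⟨a + c, b + d, by simp [h₁, h₃], by simp [h₂, h₄],
    add_nonneg ha hc, add_nonneg hb hd⟩

theorem eq_zero_of_add_eq_zero {Z W : BC} (hZ : Z ∈ hypPos) (hW : W ∈ hypPos)
    (h : Z + W = 0) : Z = 0 ∧ W = 0 := by
  obtain ⟨a, b, h₁, h₂, ha, hb⟩ := (mem_hypPos_iff Z).1 hZ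
  obtain ⟨c, d, h₃, h₄, hc, hd⟩ := (mem_hypPos_iff W).1 hW
  have e₁ : a + c = 0 := by
    have := congrArg β₁ h
    rw [β₁_add, h₁, h₃, β₁_zero] at this
    exact_mod_cast this
  have e₂ : b + d = 0 := by
    have := congrArg β₂ h
    rw [β₂_add, h₂, h₄, β₂_zero] at this
    exact_mod_cast this
  have ha0 : a = 0 := by linarith
  have hb0 : b = 0 := by linarith
  have hc0 : c = 0 := by linarith
  have hd0 : d = 0 := by linarith
  exact ⟨ext_β (by simp [h₁, ha0]) (by simp [h₂, hb0]),
    ext_β (by simp [h₃, hc0]) (by simp [h₄, hd0])⟩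

theorem sum_mem_hypPos {ι : Type*} (s : Finset ι) (f : ι → BC) (hf : ∀ i ∈ s, f i ∈ hypPos) :
    ∑ i ∈ s, f i ∈ hypPos :=
  Finset.sum_induction f (· ∈ hypPos) (fun _ _ => add_mem_hypPos) zero_mem_hypPos hf

theorem mul_star_mem_hypPos (Z : BC) : Z * star Z ∈ hypPos :=
  (mem_hypPos_iff _).2 ⟨Complex.normSq Z.β₁, Complex.normSq Z.β₂,
    by simp [Complex.mul_conj], by simp [Complex.mul_conj],
    Complex.normSq_nonneg _, Complex.normSq_nonneg _⟩

theorem mul_star_eq_zero {Z : BC} (h : Z * star Z = 0) : Z = 0 := by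
  have h₁ := congrArg β₁ h
  have h₂ := congrArg β₂ h
  simp only [β₁_mul, β₁_star, β₁_zero, β₂_mul, β₂_star, β₂_zero, mul_eq_zero, star_eq_zero,
    or_self] at h₁ h₂
  exact ext_β (by simpa using h₁) (by simpa using h₂)

/-- The bidisk in idempotent coordinates. -/
def bidisk : Set BC := {Z | ‖Z.β₁‖ < 1 ∧ ‖Z.β₂‖ < 1}

theorem isUnit_one_sub_mul_star {Z W : BC} (hZ : Z ∈ bidisk) (hW : W ∈ bidisk) :
    IsUnit (1 - Z * star W) := by
  have key : ∀ a b : ℂ, ‖a‖ < 1 → ‖b‖ < 1 → (1 - a * star b) ≠ 0 := by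
    intro a b ha hb h
    have h1 : ‖a * star b‖ = 1 := by rw [← sub_eq_zero.1 h]; simp
    rw [norm_mul, norm_star] at h1
    nlinarith [norm_nonneg a, norm_nonneg b]
  refine IsUnit.of_mul_eq_one (ofComplex (1 - Z.β₁ * star W.β₁)⁻¹ * e +
    ofComplex (1 - Z.β₂ * star W.β₂)⁻¹ * eDag) (ext_β ?_ ?_)
  · rw [β₁_mul, β₁_idempotent, β₁_sub, β₁_mul, β₁_star, β₁_one]
    exact mul_inv_cancel₀ (key _ _ hZ.1 hW.1)
  · rw [β₂_mul, β₂_idempotent, β₂_sub, β₂_mul, β₂_star, β₂_one]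
    exact mul_inv_cancel₀ (key _ _ hZ.2 hW.2)

/-- `F` is derivable at `Z₀`: the difference quotient has a limit as the increment tends to `0`
through invertible bicomplex numbers. -/
def DerivableAt (F : BC → BC) (Z₀ : BC) : Prop :=
  ∃ L : BC, Filter.Tendsto (fun H : BC => (F (Z₀ + H) - F Z₀) * Ring.inverse H)
    (nhdsWithin 0 {H : BC | IsUnit H}) (nhds L)

end BC

open BC

/-- A bicomplex matrix valued function is `BC`-holomorphic on the (open) set `Ω` if each entry is
derivable at each point of `Ω`. -/
def IsBCHolomorphicOn {n m : ℕ} (s : BC → Matrix (Fin n) (Fin m) BC) (Ω : Set BC) : Prop :=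
  ∀ Z ∈ Ω, ∀ i j, DerivableAt (fun W => s W i j) Z

open scoped Matrix.Norms.L2Operator in
/-- The classical Schur class `𝒮^{n×m}(𝕂)`: matrix functions holomorphic in the open unit disk,
with values that are contractions `ℂ^m → ℂ^n` for the Euclidean norms. -/
def IsClassicalSchur {n m : ℕ} (S : ℂ → Matrix (Fin n) (Fin m) ℂ) : Prop :=
  (∀ i j, DifferentiableOn ℂ (fun z => S z i j) (Metric.ball 0 1)) ∧
    ∀ z ∈ Metric.ball (0 : ℂ) 1, ‖S z‖ ≤ 1

/-- The bicomplex Schur class: `s(Z) = s₁(β₁) 𝐞 + s₂(β₂) 𝐞†` with `s₁, s₂` classical. -/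
def IsBCSchur {n m : ℕ} (s : BC → Matrix (Fin n) (Fin m) BC) : Prop :=
  IsBCHolomorphicOn s bidisk ∧
    ∃ s₁ s₂ : ℂ → Matrix (Fin n) (Fin m) ℂ, IsClassicalSchur s₁ ∧ IsClassicalSchur s₂ ∧
      ∀ Z ∈ bidisk, ∀ i j, s Z i j = ofComplex (s₁ Z.β₁ i j) * e + ofComplex (s₂ Z.β₂ i j) * eDag

/-- Hyperbolic positive matrices: `∗`-Hermitian, with `c^{∗t} A c ∈ 𝔻⁺` for all columns `c`. -/
def IsHypPositive {n : ℕ} (A : Matrix (Fin n) (Fin n) BC) : Prop :=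
  A.IsHermitian ∧ ∀ c : Fin n → BC, star c ⬝ᵥ (A.mulVec c) ∈ hypPos

/-- The order of bicomplex matrices: `A ≤ B` when `B - A` is hyperbolic positive. -/
def BCMatrixLE {n : ℕ} (A B : Matrix (Fin n) (Fin n) BC) : Prop := IsHypPositive (B - A)

/-- Positive definite bicomplex matrix valued kernels on a set `Ω`; the test columns are in
`ℂ(𝐢)^n`. -/
def IsPosDefKernelOn {X : Type*} {n : ℕ} (K : X → X → Matrix (Fin n) (Fin n) BC)
    (Ω : Set X) : Prop :=
  (∀ z ∈ Ω, ∀ w ∈ Ω, K z w = (K w z).conjTranspose) ∧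
    ∀ (N : ℕ) (c : Fin N → Fin n → ℂ) (z : Fin N → X), (∀ j, z j ∈ Ω) →
      ∑ l, ∑ j, (star (fun i => ofComplex (c j i)) : Fin n → BC) ⬝ᵥ
        ((K (z j) (z l)).mulVec fun i => ofComplex (c l i)) ∈ hypPos

/-- `f(Z) = ∑ aₙ Zⁿ` on the bidisk, with `∑ |aₙ|_𝐤² = ∑ aₙ aₙ^∗` convergent. -/
def IsHardyExpansion (f : BC → BC) (a : ℕ → BC) : Prop :=
  Summable (fun n => a n * star (a n)) ∧ ∀ Z ∈ bidisk, HasSum (fun n => a n * Z ^ n) (f Z)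

/-- Membership in the bicomplex Hardy space of the bidisk; only the values of `f` on the bidisk
matter. -/
def MemHardy (f : BC → BC) : Prop := ∃ a : ℕ → BC, IsHardyExpansion f a

open Classical in
/-- The (unique) sequence of coefficients of a function of the Hardy space. -/
def hardyCoeff (f : BC → BC) : ℕ → BC := if h : MemHardy f then h.choose else 0

/-- The `BC`-valued inner product `∑ fₙ gₙ^∗` of the bicomplex Hardy space. -/
def hardyInner (f g : BC → BC) : BC := ∑' n, hardyCoeff f n * star (hardyCoeff g n)

/-- The inner product of the finite direct power of the bicomplex Hardy space. -/
def hardyInnerVec {m : ℕ} (f g : Fin m → BC → BC) : BC := ∑ i, hardyInner (f i) (g i)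

/-- The product of a matrix function and a column of functions. -/
def mulFun {n m : ℕ} (s : BC → Matrix (Fin n) (Fin m) BC) (f : Fin m → BC → BC) :
    Fin n → BC → BC :=
  fun i Z => (s Z).mulVec (fun j => f j Z) i

/-- Multiplication by `s` is a `𝔻`-contraction from `(𝐇²)^m` into `(𝐇²)^n`. -/
def IsHardyContraction {n m : ℕ} (s : BC → Matrix (Fin n) (Fin m) BC) : Prop :=
  ∀ f : Fin m → BC → BC, (∀ j, MemHardy (f j)) →
    (∀ i, MemHardy (mulFun s f i)) ∧
      hypLE (hardyInnerVec (mulFun s f) (mulFun s f)) (hardyInnerVec f f)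

/-- `BC`-modules with a `BC`-valued inner product. -/
class BCInnerProductModule (X : Type*) [AddCommGroup X] [Module BC X] where
  inner : X → X → BC
  inner_add_right : ∀ x y z, inner x (y + z) = inner x y + inner x z
  inner_smul_left : ∀ (μ : BC) (x y), inner (μ • x) y = μ * inner x y
  inner_conj_symm : ∀ x y, inner x y = star (inner y x)
  inner_self_mem : ∀ x, inner x x ∈ hypPos
  inner_self_eq_zero : ∀ x, inner x x = 0 ↔ x = 0

/-- The `BC`-valued inner product. -/
def bcInner {X : Type*} [AddCommGroup X] [Module BC X] [BCInnerProductModule X] (x y : X) : BC :=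
  BCInnerProductModule.inner x y

/-- The canonical inner product `∑ Zᵢ Wᵢ^∗` of `BC^n`. -/
instance (n : ℕ) : BCInnerProductModule (Fin n → BC) where
  inner Z W := ∑ i, Z i * star (W i)
  inner_add_right x y z := by simp [mul_add, Finset.sum_add_distrib]
  inner_smul_left μ x y := by simp [Finset.mul_sum, mul_assoc]
  inner_conj_symm x y := by simp [star_sum, mul_comm]
  inner_self_mem x := sum_mem_hypPos _ _ fun i _ => mul_star_mem_hypPos (x i)
  inner_self_eq_zero x := by
    constructor
    · intro h
      funext i
      rw [← Finset.add_sum_erase _ _ (Finset.mem_univ i)] at h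
      exact mul_star_eq_zero (eq_zero_of_add_eq_zero (mul_star_mem_hypPos _)
        (sum_mem_hypPos _ _ fun j _ => mul_star_mem_hypPos (x j)) h).1
    · rintro rfl; simp

/-- The orthogonal direct sum of two `BC`-inner product modules. -/
instance (X Y : Type*) [AddCommGroup X] [Module BC X] [BCInnerProductModule X]
    [AddCommGroup Y] [Module BC Y] [BCInnerProductModule Y] : BCInnerProductModule (X × Y) where
  inner p q := bcInner p.1 q.1 + bcInner p.2 q.2
  inner_add_right x y z := by
    simp only [bcInner, Prod.fst_add, Prod.snd_add, BCInnerProductModule.inner_add_right]; ring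
  inner_smul_left μ x y := by
    simp only [bcInner, Prod.smul_fst, Prod.smul_snd, BCInnerProductModule.inner_smul_left]; ring
  inner_conj_symm x y := by
    rw [star_add]
    exact congrArg₂ _ (BCInnerProductModule.inner_conj_symm _ _)
      (BCInnerProductModule.inner_conj_symm _ _)
  inner_self_mem x := add_mem_hypPos (BCInnerProductModule.inner_self_mem _)
    (BCInnerProductModule.inner_self_mem _)
  inner_self_eq_zero x := by
    constructor
    · intro h
      have := eq_zero_of_add_eq_zero (BCInnerProductModule.inner_self_mem _)
        (BCInnerProductModule.inner_self_mem _) h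
      exact Prod.ext ((BCInnerProductModule.inner_self_eq_zero _).1 this.1)
        ((BCInnerProductModule.inner_self_eq_zero _).1 this.2)
    · rintro rfl
      simp [bcInner, (BCInnerProductModule.inner_self_eq_zero (0 : X)).2 rfl,
        (BCInnerProductModule.inner_self_eq_zero (0 : Y)).2 rfl]

section Operators

variable {X Y : Type*} [AddCommGroup X] [Module BC X] [BCInnerProductModule X]
  [AddCommGroup Y] [Module BC Y] [BCInnerProductModule Y]

/-- The hyperbolic norm `‖x‖_𝔻 = ⟨x, x⟩^{1/2}`, the root being taken in each idempotent
component. -/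
def hypNorm (x : X) : BC :=
  ofComplex (Real.sqrt (bcInner x x).β₁.re) * e + ofComplex (Real.sqrt (bcInner x x).β₂.re) * eDag

/-- The Euclidean-type norm of a `BC`-inner product module: `‖x‖²` is half of the sum of the two
idempotent components of `⟨x, x⟩`. -/
def euclNorm (x : X) : ℝ := Real.sqrt (((bcInner x x).β₁.re + (bcInner x x).β₂.re) / 2)

variable (X) in
/-- A bicomplex Hilbert module: every Cauchy sequence for the Euclidean-type norm converges. -/
def IsBCHilbert : Prop :=
  ∀ u : ℕ → X, (∀ ε : ℝ, 0 < ε → ∃ N, ∀ p ≥ N, ∀ q ≥ N, euclNorm (u p - u q) < ε) →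
    ∃ x : X, ∀ ε : ℝ, 0 < ε → ∃ N, ∀ p ≥ N, euclNorm (u p - x) < ε

/-- `𝔻`-bounded linear operators. -/
def IsDBounded (T : X →ₗ[BC] Y) : Prop :=
  ∃ Λ ∈ hypPos, ∀ x, hypLE (hypNorm (T x)) (Λ * hypNorm x)

/-- `S = T^♯`: the operator `S` is the adjoint of `T`. -/
def IsBCAdjoint (T : X →ₗ[BC] Y) (S : Y →ₗ[BC] X) : Prop :=
  ∀ x y, bcInner (T x) y = bcInner x (S y)

/-- Coisometric operators: `T` is `𝔻`-bounded and `T T^♯ = I`. -/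
def IsCoisometric (T : X →ₗ[BC] Y) : Prop :=
  IsDBounded T ∧ ∃ S : Y →ₗ[BC] X, IsBCAdjoint T S ∧ T ∘ₗ S = LinearMap.id

end Operators

/-- `s(Z) = D + Z C (I - Z A)⁻¹ B` on the bidisk, where the block operator
`(A B; C D) : 𝓗 ⊕ BC^m → 𝓗 ⊕ BC^n` is coisometric and `𝓗` is a bicomplex Hilbert module. -/
def HasCoisometricRealization {n m : ℕ} (s : BC → Matrix (Fin n) (Fin m) BC) : Prop :=
  ∃ (H : Type u) (_ : AddCommGroup H) (_ : Module BC H) (_ : BCInnerProductModule H),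
    IsBCHilbert H ∧
    ∃ (A : H →ₗ[BC] H) (B : (Fin m → BC) →ₗ[BC] H) (C : H →ₗ[BC] (Fin n → BC))
      (D : (Fin m → BC) →ₗ[BC] (Fin n → BC)),
      IsCoisometric ((A.coprod B).prod (C.coprod D)) ∧
      ∀ Z ∈ bidisk, IsUnit ((1 : Module.End BC H) - Z • A) ∧
        (s Z).mulVecLin = D + Z • (C ∘ₗ Ring.inverse ((1 : Module.End BC H) - Z • A) ∘ₗ B)

end

/-!
Everything is reduced to the idempotent components. The two ring homomorphisms `BC.proj l` identify
`BC` with `ℂ × ℂ`, compatibly with the topology, the conjugation and the order. A `BC`-holomorphic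
function on the bidisk splits into a holomorphic function of `β₁` and one of `β₂`
(`BC.exists_split_of_derivableAt`): the difference quotients converge although both increments
move, so comparing them at `(a, b)` and at `(a, b + k)` shows that a component is locally constant
in the other variable. Each of the five conditions then says that both components `S` of `s` are
classical Schur functions, and the work is the classical theory for one disk.

From contractivity, Parseval's identity on circles (`HasDiskExpansion.hasSum_sq`) turns the pointwise
bound `|S f|² ≤ |f|²` into the bound for Hardy norms (`HasDiskExpansion.sum_tsum_sq_le`), so
multiplication by `S` is a contraction `M` of Hardy spaces. Its adjoint maps the reproducing kernel
function `k_w u` to `k_w (S(w)ᴴ u)`, hence the quadratic form of the kernel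
`(1 - S(z) S(w)ᴴ) / (1 - z w̄)` is `‖f‖² - ‖M† f‖²` (`IsSchurDisk.kernel_nonneg`). For the realization,
the state space is the closure of the range of the defect operator `ρ = (1 - M M†)^{1/2}`. Since
`M†` commutes with the backward shift `b`, the map `(ρ b f, f(0)) ↦ (ρ f, (M† f)(0))` is isometric
(`exists_isometry_of_contraction`), and its adjoint is the required coisometry
(`IsSchurDisk.nonempty_realization`).

Conversely, the kernel condition at a single point and the Hardy space condition on kernel functions
both give contractivity pointwise. A coisometric block operator is a contraction that maps
`(Z x, v)` to `(x, s(Z) v)` for `x = (1 - Z A)⁻¹ B v`, so that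
`⟨x, x⟩ + ⟨s(Z) v, s(Z) v⟩ ⋖ Z Z^∗ ⟨x, x⟩ + ⟨v, v⟩`, which makes `s(Z)` a contraction.
-/

open BC Metric

/-! ### Power series on the unit disk and Parseval's identity -/

/-- `g(z) = ∑ aₖ zᵏ` on the open unit disk. -/
def HasDiskExpansion (a : ℕ → ℂ) (g : ℂ → ℂ) : Prop :=
  ∀ z ∈ ball (0 : ℂ) 1, HasSum (fun k => a k * z ^ k) (g z)

namespace HasDiskExpansion

variable {a b : ℕ → ℂ} {f g : ℂ → ℂ}

theorem summable_norm (h : HasDiskExpansion a g) {z : ℂ} (hz : z ∈ ball (0 : ℂ) 1) :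
    Summable fun k => ‖a k * z ^ k‖ :=
  (h z hz).summable.norm

theorem summable_norm_mul_pow (h : HasDiskExpansion a g) {r : ℝ} (hr₀ : 0 ≤ r) (hr : r < 1) :
    Summable fun k => ‖a k‖ * r ^ k := by
  have hz : (r : ℂ) ∈ ball (0 : ℂ) 1 := by simpa [abs_of_nonneg hr₀] using hr
  simpa [abs_of_nonneg hr₀] using h.summable_norm hz

theorem of_differentiableOn (hg : DifferentiableOn ℂ g (ball 0 1)) :
    HasDiskExpansion (fun k => (k.factorial : ℂ)⁻¹ * iteratedDeriv k g 0) g := by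
  intro z hz
  have := Complex.hasSum_taylorSeries_on_ball hg hz
  refine this.congr_fun fun k => ?_
  simp only [sub_zero, smul_eq_mul]
  ring

theorem add (hf : HasDiskExpansion a f) (hg : HasDiskExpansion b g) :
    HasDiskExpansion (fun k => a k + b k) fun z => f z + g z := fun z hz =>
  ((hf z hz).add (hg z hz)).congr_fun fun k => by ring

theorem const_mul (hf : HasDiskExpansion a f) (c : ℂ) :
    HasDiskExpansion (fun k => c * a k) fun z => c * f z := fun z hz =>
  ((hf z hz).mul_left c).congr_fun fun k => by ring

theorem sum {ι : Type*} (s : Finset ι) {a : ι → ℕ → ℂ} {f : ι → ℂ → ℂ}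
    (h : ∀ i ∈ s, HasDiskExpansion (a i) (f i)) :
    HasDiskExpansion (fun k => ∑ i ∈ s, a i k) fun z => ∑ i ∈ s, f i z := fun z hz =>
  (hasSum_sum fun i hi => h i hi z hz).congr_fun fun _ => Finset.sum_mul _ _ _

/-- The Cauchy product. -/
theorem mul (hf : HasDiskExpansion a f) (hg : HasDiskExpansion b g) :
    HasDiskExpansion (fun k => ∑ p ∈ Finset.HasAntidiagonal.antidiagonal k, a p.1 * b p.2)
      fun z => f z * g z := by
  intro z hz
  have hs := summable_norm_sum_mul_antidiagonal_of_summable_norm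
    (hf.summable_norm hz) (hg.summable_norm hz)
  have ht := tsum_mul_tsum_eq_tsum_sum_antidiagonal_of_summable_norm
    (hf.summable_norm hz) (hg.summable_norm hz)
  rw [(hf z hz).tsum_eq, (hg z hz).tsum_eq] at ht
  simp only [ht]
  refine hs.of_norm.hasSum.congr_fun fun k => ?_
  rw [Finset.sum_mul]
  refine Finset.sum_congr rfl fun p hp => ?_
  rw [← Finset.HasAntidiagonal.mem_antidiagonal.1 hp, pow_add]
  ring

/-- Multiplication by `z` shifts the coefficients. -/
theorem shift (hf : HasDiskExpansion a f) :
    HasDiskExpansion (fun k => k.casesOn 0 a) fun z => z * f z := by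
  intro z hz
  rw [← hasSum_nat_add_iff' 1]
  rw [Finset.sum_range_one]
  refine HasSum.congr_fun (f := fun k => z * (a k * z ^ k)) ?_ fun k => by ring
  simpa using (hf z hz).mul_left z

theorem geometric {w : ℂ} (hw : w ∈ ball (0 : ℂ) 1) :
    HasDiskExpansion (fun k => w ^ k) fun z => (1 - w * z)⁻¹ := by
  intro z hz
  simp only [← mul_pow]
  refine hasSum_geometric_of_norm_lt_one ?_
  rw [mem_ball_zero_iff] at hw hz
  rw [norm_mul]
  nlinarith [norm_nonneg w, norm_nonneg z]

end HasDiskExpansion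

theorem integral_exp_int_mul_I (j : ℤ) :
    ∫ θ in (0 : ℝ)..2 * Real.pi, Complex.exp ((j * Complex.I) * θ) =
      if j = 0 then ((2 * Real.pi : ℝ) : ℂ) else 0 := by
  split_ifs with h
  · simp [h]
  · rw [integral_exp_mul_complex (by simpa using h)]
    have : (j : ℂ) * Complex.I * ((2 * Real.pi : ℝ) : ℂ) = j * (2 * Real.pi * Complex.I) := by
      push_cast; ring
    rw [this, Complex.exp_int_mul_two_pi_mul_I]
    simp

/-- Parseval's identity on a circle inside the disk of convergence. -/
theorem HasDiskExpansion.hasSum_sq {a : ℕ → ℂ} {g : ℂ → ℂ} (h : HasDiskExpansion a g) {r : ℝ}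
    (hr₀ : 0 ≤ r) (hr : r < 1) :
    HasSum (fun k => ‖a k‖ ^ 2 * r ^ (2 * k)) (Real.circleAverage (fun z => ‖g z‖ ^ 2) 0 r) := by
  set u : ℕ → ℂ := fun k => a k * r ^ k with hu
  have hus : Summable fun k => ‖u k‖ := by
    simpa [hu, abs_of_nonneg hr₀] using h.summable_norm_mul_pow hr₀ hr
  have hball : ∀ θ, circleMap 0 r θ ∈ ball (0 : ℂ) 1 := fun θ => by
    simpa [abs_of_nonneg hr₀] using hr
  -- `|g|²` as a double series; after integration only its diagonal survives.
  set F : ℕ × ℕ → ℝ → ℂ := fun p θ =>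
    (u p.1 * star (u p.2)) * Complex.exp ((((p.1 : ℤ) - (p.2 : ℤ) : ℤ) * Complex.I) * θ) with hF
  have hterm : ∀ p θ, F p θ = (a p.1 * circleMap 0 r θ ^ p.1) *
      star (a p.2 * circleMap 0 r θ ^ p.2) := by
    intro p θ
    have h1 : ∀ k : ℕ, a k * circleMap 0 r θ ^ k = u k * Complex.exp (k * Complex.I * θ) := by
      intro k
      rw [circleMap_zero, mul_pow, ← Complex.exp_nat_mul, hu]
      simp only [mul_assoc, mul_comm Complex.I]
    have h2 : star (Complex.exp (p.2 * Complex.I * θ)) = Complex.exp (-(p.2 * Complex.I * θ)) := by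
      rw [Complex.star_def, ← Complex.exp_conj]
      congr 1
      simp
    rw [h1, h1, star_mul, h2, hF]
    simp only
    push_cast
    rw [show ((p.1 : ℂ) - p.2) * Complex.I * θ = p.1 * Complex.I * θ + -(p.2 * Complex.I * θ) by
      ring, Complex.exp_add]
    ring
  have hsum : ∀ θ, HasSum (fun p => F p θ) ((‖g (circleMap 0 r θ)‖ ^ 2 : ℝ) : ℂ) := by
    intro θ
    have h1 := h _ (hball θ)
    have h2 := h1.star
    have hn := h.summable_norm (hball θ)
    have hn' : Summable fun k => ‖star (a k * circleMap 0 r θ ^ k)‖ := by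
      simpa only [norm_star] using hn
    have h3 := h1.mul h2 (summable_mul_of_summable_norm (f := fun k => a k * circleMap 0 r θ ^ k)
      (g := fun k => star (a k * circleMap 0 r θ ^ k)) hn hn')
    have h4 : g (circleMap 0 r θ) * star (g (circleMap 0 r θ)) =
        ((‖g (circleMap 0 r θ)‖ ^ 2 : ℝ) : ℂ) := by
      rw [Complex.star_def, Complex.mul_conj, Complex.normSq_eq_norm_sq]
    rw [h4] at h3
    exact h3.congr_fun fun p => hterm p θ
  have hbound : ∀ p θ, ‖F p θ‖ = ‖u p.1‖ * ‖u p.2‖ := by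
    intro p θ
    rw [hF]
    simp only [norm_mul, norm_star]
    rw [show (((p.1 : ℤ) - (p.2 : ℤ) : ℤ) : ℂ) * Complex.I * θ =
      (((((p.1 : ℤ) - (p.2 : ℤ) : ℤ) : ℝ) * θ : ℝ) : ℂ) * Complex.I by push_cast; ring,
      Complex.norm_exp_ofReal_mul_I, mul_one]
  have hint := intervalIntegral.hasSum_integral_of_dominated_convergence
    (μ := MeasureTheory.volume) (a := 0) (b := 2 * Real.pi) (F := F)
    (f := fun θ => ((‖g (circleMap 0 r θ)‖ ^ 2 : ℝ) : ℂ))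
    (fun p _ => ‖u p.1‖ * ‖u p.2‖)
    (fun p => (by simp only [hF]; fun_prop : Continuous (F p)).aestronglyMeasurable)
    (fun p => Filter.Eventually.of_forall fun θ _ => (hbound p θ).le)
    (Filter.Eventually.of_forall fun θ _ => hus.mul_of_nonneg hus
      (fun _ => norm_nonneg _) (fun _ => norm_nonneg _))
    intervalIntegrable_const
    (Filter.Eventually.of_forall fun θ _ => hsum θ)
  have hval : ∀ p : ℕ × ℕ, ∫ θ in (0 : ℝ)..2 * Real.pi, F p θ =
      if p.1 = p.2 then u p.1 * star (u p.2) * ((2 * Real.pi : ℝ) : ℂ) else 0 := by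
    intro p
    rw [hF]
    simp only
    rw [intervalIntegral.integral_const_mul, integral_exp_int_mul_I]
    simp only [sub_eq_zero, Nat.cast_inj]
    split_ifs <;> simp
  simp only [hval] at hint
  rw [intervalIntegral.integral_ofReal] at hint
  have hdiag : Function.Injective fun k : ℕ => (k, k) := fun k l hkl => (Prod.ext_iff.1 hkl).1
  rw [← hdiag.hasSum_iff (by
    intro p hp
    rw [if_neg]
    rintro hpp
    exact hp ⟨p.1, Prod.ext rfl hpp⟩)] at hint
  have hre : HasSum (fun k => ‖u k‖ ^ 2 * (2 * Real.pi))
      (∫ θ in (0 : ℝ)..2 * Real.pi, ‖g (circleMap 0 r θ)‖ ^ 2) := by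
    rw [← Complex.hasSum_ofReal]
    refine hint.congr_fun fun k => ?_
    simp only [Function.comp, if_true]
    rw [Complex.star_def, Complex.mul_conj, Complex.normSq_eq_norm_sq]
    push_cast
    ring
  rw [Real.circleAverage_def, smul_eq_mul]
  refine (hre.mul_left (2 * Real.pi)⁻¹).congr_fun fun k => ?_
  have hpi := Real.pi_ne_zero
  simp only [hu, norm_mul, norm_pow, Complex.norm_real, Real.norm_eq_abs, abs_of_nonneg hr₀]
  field_simp
  ring

/-- Uniqueness of Taylor coefficients, from Parseval's identity for the difference. -/
theorem HasDiskExpansion.unique {a b : ℕ → ℂ} {g : ℂ → ℂ} (ha : HasDiskExpansion a g)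
    (hb : HasDiskExpansion b g) : a = b := by
  have h0 : HasDiskExpansion (fun k => a k - b k) fun _ => 0 := fun z hz => by
    simpa [sub_mul] using (ha z hz).sub (hb z hz)
  have h1 := h0.hasSum_sq (r := 1 / 2) (by norm_num) (by norm_num)
  have h2 : Real.circleAverage (fun _ : ℂ => ‖(0 : ℂ)‖ ^ 2) 0 (1 / 2) = 0 := by
    simp [Real.circleAverage_const]
  rw [h2, hasSum_zero_iff_of_nonneg fun k => by positivity] at h1
  funext k
  have h3 := congrFun h1 k
  simpa [sub_eq_zero] using h3

theorem HasDiskExpansion.continuousOn {a : ℕ → ℂ} {g : ℂ → ℂ} (h : HasDiskExpansion a g)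
    {r : ℝ} (hr₀ : 0 ≤ r) (hr : r < 1) : ContinuousOn g (closedBall 0 r) := by
  have hsub : closedBall (0 : ℂ) r ⊆ ball 0 1 := closedBall_subset_ball hr
  have : ContinuousOn (fun z => ∑' k, a k * z ^ k) (closedBall 0 r) := by
    refine continuousOn_tsum (fun k => by fun_prop) (h.summable_norm_mul_pow hr₀ hr) ?_
    intro k z hz
    rw [norm_mul, norm_pow]
    gcongr
    simpa using hz
  exact this.congr fun z hz => (h z (hsub hz)).tsum_eq.symm

/-- If `∑ᵢ |gᵢ|² ≤ ∑ⱼ |fⱼ|²` pointwise in the disk and the `fⱼ` belong to the Hardy space, then the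
`gᵢ` belong to it too, and the inequality passes to the norms. -/
theorem HasDiskExpansion.sum_tsum_sq_le {ι κ : Type*} [Fintype ι] [Fintype κ] {a : κ → ℕ → ℂ}
    {b : ι → ℕ → ℂ} {f : κ → ℂ → ℂ} {g : ι → ℂ → ℂ} (ha : ∀ j, HasDiskExpansion (a j) (f j))
    (hb : ∀ i, HasDiskExpansion (b i) (g i)) (has : ∀ j, Summable fun k => ‖a j k‖ ^ 2)
    (hle : ∀ z ∈ ball (0 : ℂ) 1, ∑ i, ‖g i z‖ ^ 2 ≤ ∑ j, ‖f j z‖ ^ 2) :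
    (∀ i, Summable fun k => ‖b i k‖ ^ 2) ∧
      ∑ i, ∑' k, ‖b i k‖ ^ 2 ≤ ∑ j, ∑' k, ‖a j k‖ ^ 2 := by
  set T := ∑ j, ∑' k, ‖a j k‖ ^ 2 with hT
  have hci : ∀ {c : ℕ → ℂ} {φ : ℂ → ℂ}, HasDiskExpansion c φ → ∀ {r : ℝ}, 0 ≤ r → r < 1 →
      CircleIntegrable (fun z => ‖φ z‖ ^ 2) 0 r := fun hc r hr₀ hr =>
    ContinuousOn.circleIntegrable hr₀
      (((hc.continuousOn hr₀ hr).mono sphere_subset_closedBall).norm.pow 2)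
  have hr : ∀ (N : ℕ) (r : ℝ), 0 ≤ r → r < 1 →
      ∑ k ∈ Finset.range N, (∑ i, ‖b i k‖ ^ 2) * r ^ (2 * k) ≤ T := by
    intro N r hr₀ hr
    calc ∑ k ∈ Finset.range N, (∑ i, ‖b i k‖ ^ 2) * r ^ (2 * k)
        = ∑ i, ∑ k ∈ Finset.range N, ‖b i k‖ ^ 2 * r ^ (2 * k) := by
          rw [Finset.sum_comm]; simp only [Finset.sum_mul]
      _ ≤ ∑ i, Real.circleAverage (fun z => ‖g i z‖ ^ 2) 0 r :=
          Finset.sum_le_sum fun i _ =>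
            sum_le_hasSum _ (fun k _ => by positivity) ((hb i).hasSum_sq hr₀ hr)
      _ = Real.circleAverage (fun z => ∑ i, ‖g i z‖ ^ 2) 0 r :=
          (Real.circleAverage_fun_sum fun i _ => hci (hb i) hr₀ hr).symm
      _ ≤ Real.circleAverage (fun z => ∑ j, ‖f j z‖ ^ 2) 0 r := by
          refine Real.circleAverage_mono (.fun_sum _ fun i _ => hci (hb i) hr₀ hr)
            (.fun_sum _ fun i _ => hci (ha i) hr₀ hr) fun z hz => hle z ?_
          rw [abs_of_nonneg hr₀] at hz
          exact sphere_subset_ball hr hz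
      _ = ∑ j, Real.circleAverage (fun z => ‖f j z‖ ^ 2) 0 r :=
          Real.circleAverage_fun_sum fun i _ => hci (ha i) hr₀ hr
      _ ≤ T := by
          refine Finset.sum_le_sum fun j _ => hasSum_le (fun k => ?_)
            ((ha j).hasSum_sq hr₀ hr) (has j).hasSum
          exact mul_le_of_le_one_right (by positivity) (pow_le_one₀ hr₀ hr.le)
  -- Let `r → 1` in the partial sums.
  have hN : ∀ N : ℕ, ∑ k ∈ Finset.range N, ∑ i, ‖b i k‖ ^ 2 ≤ T := by
    intro N
    have hcont : Continuous fun r : ℝ =>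
      ∑ k ∈ Finset.range N, (∑ i, ‖b i k‖ ^ 2) * r ^ (2 * k) := by fun_prop
    have hlim := (hcont.tendsto 1).mono_left (nhdsWithin_le_nhds (s := Set.Iio 1))
    simp only [one_pow, mul_one] at hlim
    refine le_of_tendsto hlim ?_
    filter_upwards [Ioo_mem_nhdsLT (zero_lt_one' ℝ)] with r hr'
    exact hr N r hr'.1.le hr'.2
  have hsum : ∀ i, Summable fun k => ‖b i k‖ ^ 2 := fun i =>
    summable_of_sum_range_le (c := T) (fun k => by positivity) fun N =>
      (Finset.sum_le_sum fun k _ => Finset.single_le_sum (f := fun i => ‖b i k‖ ^ 2)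
        (fun _ _ => by positivity) (Finset.mem_univ i)).trans (hN N)
  refine ⟨hsum, ?_⟩
  rw [← Summable.tsum_finsetSum fun i _ => hsum i]
  exact Real.tsum_le_of_sum_range_le (fun k => by positivity) hN

/-- Point evaluation at `w` on the Hardy space has norm at most `(1 - |w|²)^{-1/2}`. -/
theorem norm_tsum_mul_pow_sq_le {a : ℕ → ℂ} (ha : Summable fun k => ‖a k‖ ^ 2) {w : ℂ}
    (hw : w ∈ ball (0 : ℂ) 1) : Summable (fun k => a k * w ^ k) ∧
      ‖∑' k, a k * w ^ k‖ ^ 2 ≤ (∑' k, ‖a k‖ ^ 2) * (1 - ‖w‖ ^ 2)⁻¹ := by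
  have hw' : ‖w‖ ^ 2 < 1 := by
    rw [mem_ball_zero_iff] at hw
    nlinarith [norm_nonneg w]
  have hg : HasSum (fun k => (‖w‖ ^ k) ^ 2) (1 - ‖w‖ ^ 2)⁻¹ := by
    simpa only [← pow_mul, mul_comm 2] using hasSum_geometric_of_lt_one (sq_nonneg ‖w‖) hw'
  have hconj : (2 : ℝ).HolderConjugate 2 := Real.HolderConjugate.two_two
  have ha' : Summable fun k => ‖a k‖ ^ (2 : ℝ) := by simpa using ha
  have hg' : Summable fun k => (‖w‖ ^ k) ^ (2 : ℝ) := by simpa using hg.summable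
  have hs : Summable fun k => ‖a k‖ * ‖w‖ ^ k :=
    Real.summable_mul_of_Lp_Lq_of_nonneg hconj (fun _ => norm_nonneg _)
      (fun _ => by positivity) ha' hg'
  have hs' : Summable fun k => ‖a k * w ^ k‖ := by simpa using hs
  refine ⟨hs'.of_norm, ?_⟩
  have h1 := Real.inner_le_Lp_mul_Lq_tsum_of_nonneg hconj (fun k => norm_nonneg (a k))
    (fun k => by positivity) ha' hg'
  simp only [Real.rpow_ofNat, ← Real.sqrt_eq_rpow] at h1
  have h2 : ‖∑' k, a k * w ^ k‖ ≤ √(∑' k, ‖a k‖ ^ 2) * √(∑' k, (‖w‖ ^ k) ^ 2) :=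
    (norm_tsum_le_tsum_norm hs').trans (by simpa using h1)
  rw [hg.tsum_eq] at h2
  calc ‖∑' k, a k * w ^ k‖ ^ 2 ≤ (√(∑' k, ‖a k‖ ^ 2) * √(1 - ‖w‖ ^ 2)⁻¹) ^ 2 := by gcongr
    _ = _ := by
      rw [mul_pow, Real.sq_sqrt (tsum_nonneg fun _ => by positivity),
        Real.sq_sqrt (inv_nonneg.2 (by linarith))]

theorem HasDiskExpansion.of_summable_sq {a : ℕ → ℂ} (ha : Summable fun k => ‖a k‖ ^ 2) :
    HasDiskExpansion a fun z => ∑' k, a k * z ^ k := fun _ hz =>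
  (norm_tsum_mul_pow_sq_le ha hz).1.hasSum

/-! ### The vector valued Hardy space and multiplication by a Schur function -/

noncomputable section

/-- The Hardy space of the disk with values in `ℂⁿ`, as the space of square summable sequences of
Taylor coefficients. -/
abbrev HardyVec (n : ℕ) : Type := lp (fun _ : ℕ => EuclideanSpace ℂ (Fin n)) 2

namespace HardyVec

variable {n m : ℕ}

theorem summable_norm_sq (f : HardyVec n) : Summable fun k => ‖f k‖ ^ 2 := by
  simpa using (lp.memℓp f).summable (by norm_num)

theorem hasSum_norm_sq (f : HardyVec n) : HasSum (fun k => ‖f k‖ ^ 2) (‖f‖ ^ 2) := by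
  simpa using lp.hasSum_norm (p := 2) (by norm_num) f

theorem norm_sq_eq_tsum (f : HardyVec n) : ‖f‖ ^ 2 = ∑' k, ‖f k‖ ^ 2 :=
  f.hasSum_norm_sq.tsum_eq.symm

/-- A square summable sequence as an element of the Hardy space. -/
def mk (f : ℕ → EuclideanSpace ℂ (Fin n)) (hf : Summable fun k => ‖f k‖ ^ 2) : HardyVec n :=
  ⟨f, memℓp_gen (by simpa using hf)⟩

@[simp] theorem mk_apply (f : ℕ → EuclideanSpace ℂ (Fin n)) (hf) (k : ℕ) : mk f hf k = f k := rfl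

theorem summable_coord_sq (f : HardyVec n) (i : Fin n) : Summable fun k => ‖f k i‖ ^ 2 := by
  refine f.summable_norm_sq.of_nonneg_of_le (fun k => by positivity) fun k => ?_
  rw [EuclideanSpace.norm_sq_eq]
  exact Finset.single_le_sum (f := fun i => ‖f k i‖ ^ 2) (fun _ _ => by positivity)
    (Finset.mem_univ i)

theorem norm_sq_eq_sum_tsum (f : HardyVec n) : ‖f‖ ^ 2 = ∑ i, ∑' k, ‖f k i‖ ^ 2 := by
  rw [norm_sq_eq_tsum, ← Summable.tsum_finsetSum fun i _ => f.summable_coord_sq i]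
  simp only [EuclideanSpace.norm_sq_eq]

/-- The value at `z` of the `i`-th coordinate function of `f`. -/
def eval (f : HardyVec n) (i : Fin n) (z : ℂ) : ℂ := ∑' k, f k i * z ^ k

theorem hasDiskExpansion (f : HardyVec n) (i : Fin n) :
    HasDiskExpansion (fun k => f k i) (f.eval i) :=
  .of_summable_sq (f.summable_coord_sq i)

theorem eval_add (f g : HardyVec n) (i : Fin n) {z : ℂ} (hz : z ∈ ball (0 : ℂ) 1) :
    (f + g).eval i z = f.eval i z + g.eval i z :=
  ((f + g).hasDiskExpansion i z hz).unique
    (((f.hasDiskExpansion i).add (g.hasDiskExpansion i)) z hz)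

theorem eval_smul (c : ℂ) (f : HardyVec n) (i : Fin n) {z : ℂ} (hz : z ∈ ball (0 : ℂ) 1) :
    (c • f).eval i z = c * f.eval i z :=
  ((c • f).hasDiskExpansion i z hz).unique ((f.hasDiskExpansion i).const_mul c z hz)

/-- The function `u + z g(z)`. -/
def cons (u : EuclideanSpace ℂ (Fin n)) (g : HardyVec n) : HardyVec n :=
  mk (fun k => k.casesOn u fun l => g l)
    ((summable_nat_add_iff (f := fun k => ‖(k.casesOn u fun l => g l : EuclideanSpace ℂ (Fin n))‖ ^ 2)
      1).1 g.summable_norm_sq)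

@[simp] theorem cons_zero (u : EuclideanSpace ℂ (Fin n)) (g : HardyVec n) : cons u g 0 = u := rfl

@[simp] theorem cons_succ (u : EuclideanSpace ℂ (Fin n)) (g : HardyVec n) (k : ℕ) :
    cons u g (k + 1) = g k := rfl

theorem eval_cons_zero (g : HardyVec n) (i : Fin n) {z : ℂ} (hz : z ∈ ball (0 : ℂ) 1) :
    (cons 0 g).eval i z = z * g.eval i z := by
  refine ((cons 0 g).hasDiskExpansion i z hz).unique ?_
  refine ((g.hasDiskExpansion i).shift z hz).congr_fun fun k => ?_
  cases k <;> simp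

/-- The value at `0`. -/
def evalZero (n : ℕ) : HardyVec n →L[ℂ] EuclideanSpace ℂ (Fin n) :=
  LinearMap.mkContinuous
    { toFun := fun f => f 0
      map_add' := fun _ _ => rfl
      map_smul' := fun _ _ => rfl } 1 fun f => by
    rw [one_mul]
    exact lp.norm_apply_le_norm (p := 2) (by norm_num) f 0

@[simp] theorem evalZero_apply (f : HardyVec n) : evalZero n f = f 0 := rfl

theorem norm_sq_eq_head_add_tail (f : HardyVec n) :
    ‖f‖ ^ 2 = (∑' k, ‖f (k + 1)‖ ^ 2) + ‖f 0‖ ^ 2 := by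
  rw [norm_sq_eq_tsum, f.summable_norm_sq.tsum_eq_zero_add, add_comm]

/-- The backward shift `f ↦ (f(z) - f(0)) / z`. -/
def backShift (n : ℕ) : HardyVec n →L[ℂ] HardyVec n :=
  LinearMap.mkContinuous
    { toFun := fun f => mk (fun k => f (k + 1)) ((summable_nat_add_iff 1).2 f.summable_norm_sq)
      map_add' := fun _ _ => rfl
      map_smul' := fun _ _ => rfl } 1 fun f => by
    refine le_of_sq_le_sq ?_ (by positivity)
    rw [one_mul, norm_sq_eq_head_add_tail f, norm_sq_eq_tsum]
    exact le_add_of_nonneg_right (by positivity)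

@[simp] theorem backShift_apply (f : HardyVec n) (k : ℕ) : backShift n f k = f (k + 1) := rfl

theorem norm_sq_backShift_add (f : HardyVec n) :
    ‖backShift n f‖ ^ 2 + ‖evalZero n f‖ ^ 2 = ‖f‖ ^ 2 := by
  rw [norm_sq_eq_head_add_tail f, norm_sq_eq_tsum]
  rfl

/-- The backward shift is the adjoint of multiplication by `z`. -/
theorem inner_backShift (f g : HardyVec n) :
    inner ℂ (backShift n f) g = inner ℂ f (cons 0 g) := by
  have h := (lp.summable_inner (𝕜 := ℂ) f (cons 0 g)).tsum_eq_zero_add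
  rw [lp.inner_eq_tsum, lp.inner_eq_tsum, h, cons_zero, inner_zero_right, zero_add]
  rfl

/-- The reproducing kernel function `u / (1 - z w̄)`. -/
def kernelVec (w : ℂ) (hw : w ∈ ball (0 : ℂ) 1) (u : EuclideanSpace ℂ (Fin n)) : HardyVec n :=
  mk (fun k => star w ^ k • u) (by
    have hw' : ‖w‖ ^ 2 < 1 := by
      rw [mem_ball_zero_iff] at hw
      nlinarith [norm_nonneg w]
    have := (summable_geometric_of_lt_one (sq_nonneg ‖w‖) hw').mul_right (‖u‖ ^ 2)
    refine this.congr fun k => ?_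
    rw [norm_smul, norm_pow, norm_star, mul_pow]
    ring)

variable {w : ℂ} (hw : w ∈ ball (0 : ℂ) 1)

@[simp] theorem kernelVec_apply (u : EuclideanSpace ℂ (Fin n)) (k : ℕ) :
    kernelVec w hw u k = star w ^ k • u := rfl

theorem backShift_kernelVec (u : EuclideanSpace ℂ (Fin n)) :
    backShift n (kernelVec w hw u) = star w • kernelVec w hw u := by
  ext k i
  simp [pow_succ]
  ring

/-- The reproducing property. -/
theorem inner_kernelVec (u : EuclideanSpace ℂ (Fin n)) (f : HardyVec n) :
    inner ℂ (kernelVec w hw u) f = ∑ i, star (u i) * f.eval i w := by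
  rw [lp.inner_eq_tsum]
  have h : HasSum (fun k => ∑ i, star (u i) * (f k i * w ^ k)) (∑ i, star (u i) * f.eval i w) :=
    hasSum_sum fun i _ => (f.hasDiskExpansion i w hw).mul_left _
  rw [← h.tsum_eq]
  refine tsum_congr fun k => ?_
  rw [PiLp.inner_apply]
  refine Finset.sum_congr rfl fun i _ => ?_
  simp
  ring

theorem eval_kernelVec {z : ℂ} (hz : z ∈ ball (0 : ℂ) 1) (u : EuclideanSpace ℂ (Fin n))
    (i : Fin n) : (kernelVec w hw u).eval i z = (1 - z * star w)⁻¹ * u i := by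
  have hw' : star w ∈ ball (0 : ℂ) 1 := by simpa using hw
  refine ((kernelVec w hw u).hasDiskExpansion i z hz).unique ?_
  rw [mul_comm z, mul_comm]
  exact (HasDiskExpansion.geometric hw').const_mul (u i) z hz |>.congr_fun fun k => by
    simp [mul_comm]

end HardyVec

/-- A matrix function on the disk whose entries are holomorphic and whose values are contractions;
the contraction property is written out in coordinates. -/
structure IsSchurDisk {n m : ℕ} (S : ℂ → Matrix (Fin n) (Fin m) ℂ) : Prop where
  differentiableOn : ∀ i j, DifferentiableOn ℂ (fun z => S z i j) (ball 0 1)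
  contractive : ∀ z ∈ ball (0 : ℂ) 1, ∀ v : Fin m → ℂ,
    ∑ i, ‖(S z).mulVec v i‖ ^ 2 ≤ ∑ j, ‖v j‖ ^ 2

namespace IsSchurDisk

variable {n m : ℕ} {S : ℂ → Matrix (Fin n) (Fin m) ℂ}

theorem exists_expansion (hS : IsSchurDisk S) {f : Fin m → ℂ → ℂ} {a : Fin m → ℕ → ℂ}
    (hf : ∀ j, HasDiskExpansion (a j) (f j)) (i : Fin n) :
    ∃ b, HasDiskExpansion b fun z => (S z).mulVec (fun j => f j z) i :=
  ⟨_, HasDiskExpansion.sum Finset.univ fun j _ =>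
    (HasDiskExpansion.of_differentiableOn (hS.differentiableOn i j)).mul (hf j)⟩

/-- Multiplication by a Schur function is a contraction between Hardy spaces; the image of `f` is
characterised by its pointwise values. -/
theorem exists_mulOperator (hS : IsSchurDisk S) :
    ∃ M : HardyVec m →L[ℂ] HardyVec n, (∀ f, ‖M f‖ ≤ ‖f‖) ∧
      ∀ f, ∀ z ∈ ball (0 : ℂ) 1, ∀ i, (M f).eval i z = (S z).mulVec (fun j => f.eval j z) i := by
  have key : ∀ f : HardyVec m, ∃ g : HardyVec n, ‖g‖ ≤ ‖f‖ ∧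
      ∀ i, HasDiskExpansion (fun k => g k i) fun z => (S z).mulVec (fun j => f.eval j z) i := by
    intro f
    choose b hb using hS.exists_expansion f.hasDiskExpansion
    obtain ⟨hbs, hle⟩ := HasDiskExpansion.sum_tsum_sq_le f.hasDiskExpansion hb
      f.summable_coord_sq fun z hz => hS.contractive z hz _
    refine ⟨HardyVec.mk (fun k => WithLp.toLp 2 fun i => b i k) ?_, ?_, hb⟩
    · simp only [EuclideanSpace.norm_sq_eq]
      exact summable_sum fun i _ => hbs i
    · refine le_of_sq_le_sq ?_ (norm_nonneg _)
      rw [HardyVec.norm_sq_eq_sum_tsum, HardyVec.norm_sq_eq_sum_tsum]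
      exact hle
  choose M hM hMexp using key
  have hext : ∀ (f : HardyVec m) (g : HardyVec n), (∀ i, ∀ z ∈ ball (0 : ℂ) 1,
      g.eval i z = (S z).mulVec (fun j => f.eval j z) i) → M f = g := by
    intro f g h
    ext k i
    refine congrFun (f := fun k => M f k i) (g := fun k => g k i)
      ((hMexp f i).unique fun z hz => ?_) k
    change HasSum _ ((S z).mulVec (fun j => f.eval j z) i)
    rw [← h i z hz]
    exact g.hasDiskExpansion i z hz
  have heval : ∀ f i, ∀ z ∈ ball (0 : ℂ) 1,
      (M f).eval i z = (S z).mulVec (fun j => f.eval j z) i := fun f i z hz =>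
    ((M f).hasDiskExpansion i z hz).unique (hMexp f i z hz)
  refine ⟨LinearMap.mkContinuous ⟨⟨M, fun f g => hext _ _ fun i z hz => ?_⟩,
    fun c f => hext _ _ fun i z hz => ?_⟩ 1 fun f => by simpa using hM f, hM,
    fun f z hz i => heval f i z hz⟩
  · rw [HardyVec.eval_add _ _ _ hz, heval _ _ _ hz, heval _ _ _ hz]
    simp only [HardyVec.eval_add _ _ _ hz]
    exact (congrFun (Matrix.mulVec_add (S z) (fun j => f.eval j z) fun j => g.eval j z) i).symm
  · simp only [RingHom.id_apply]
    rw [HardyVec.eval_smul _ _ _ hz, heval _ _ _ hz]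
    simp only [HardyVec.eval_smul _ _ _ hz]
    exact (congrFun (Matrix.mulVec_smul (S z) c fun j => f.eval j z) i).symm

end IsSchurDisk

section MulOperator

open HardyVec ContinuousLinearMap

variable {n m : ℕ} {S : ℂ → Matrix (Fin n) (Fin m) ℂ} {M : HardyVec m →L[ℂ] HardyVec n}
  (hM : ∀ f, ∀ z ∈ ball (0 : ℂ) 1, ∀ i, (M f).eval i z = (S z).mulVec (fun j => f.eval j z) i)
include hM

/-- The adjoint of multiplication by `S` maps kernel functions to kernel functions. -/
theorem adjoint_mulOperator_kernelVec {w : ℂ} (hw : w ∈ ball (0 : ℂ) 1)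
    (u : EuclideanSpace ℂ (Fin n)) :
    adjoint M (kernelVec w hw u) =
      kernelVec w hw (WithLp.toLp 2 ((S w).conjTranspose.mulVec u)) := by
  refine ext_inner_right ℂ fun f => ?_
  rw [adjoint_inner_left, inner_kernelVec, inner_kernelVec]
  simp only [hM f w hw, Matrix.mulVec, dotProduct, Matrix.conjTranspose_apply, star_sum, star_mul',
    star_star, Finset.mul_sum, Finset.sum_mul]
  rw [Finset.sum_comm]
  exact Finset.sum_congr rfl fun j _ => Finset.sum_congr rfl fun i _ => by ring

theorem mulOperator_cons_zero (f : HardyVec m) : M (cons 0 f) = cons 0 (M f) := by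
  ext k i
  refine congrFun (f := fun k => M (cons 0 f) k i) (g := fun k => cons 0 (M f) k i)
    (((M (cons 0 f)).hasDiskExpansion i).unique fun z hz => ?_) k
  rw [hM _ z hz]
  simp only [eval_cons_zero f _ hz]
  have h1 := congrFun (Matrix.mulVec_smul (S z) z fun j => f.eval j z) i
  have h2 := (cons 0 (M f)).hasDiskExpansion i z hz
  rw [eval_cons_zero _ _ hz, hM _ z hz] at h2
  simp only [Pi.smul_apply, smul_eq_mul] at h1
  rw [← h1] at h2
  exact h2

/-- The adjoint of multiplication by `S` commutes with the backward shifts. -/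
theorem backShift_adjoint_mulOperator (f : HardyVec n) :
    backShift m (adjoint M f) = adjoint M (backShift n f) := by
  refine ext_inner_right ℂ fun g => ?_
  rw [inner_backShift, adjoint_inner_left, adjoint_inner_left, inner_backShift,
    mulOperator_cons_zero hM]

end MulOperator

end

/-! ### Positivity of the kernel and coisometric realizations over `ℂ` -/

noncomputable section

theorem inner_self_eq_ofReal_norm_sq {E : Type*} [NormedAddCommGroup E] [InnerProductSpace ℂ E]
    (x : E) : inner ℂ x x = ((‖x‖ ^ 2 : ℝ) : ℂ) := by
  rw [inner_self_eq_norm_sq_to_K]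
  push_cast
  rfl

open scoped ComplexOrder in
open HardyVec in
/-- The kernel `(1 - S(z) S(w)ᴴ) / (1 - z w̄)` is positive: its quadratic form at points `zⱼ` and
vectors `cⱼ` is `‖f‖² - ‖M† f‖²`, where `f` is the sum of the corresponding reproducing kernel
functions and `M` the operator of multiplication by `S`. -/
theorem IsSchurDisk.kernel_nonneg {n m : ℕ} {S : ℂ → Matrix (Fin n) (Fin m) ℂ}
    (hS : IsSchurDisk S) {N : ℕ} (c : Fin N → Fin n → ℂ) (z : Fin N → ℂ)
    (hz : ∀ j, z j ∈ ball (0 : ℂ) 1) :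
    0 ≤ ∑ l, ∑ j, star (c j) ⬝ᵥ (((1 - z j * star (z l))⁻¹ •
      (1 - S (z j) * (S (z l)).conjTranspose)).mulVec (c l)) := by
  obtain ⟨M, hMle, hM⟩ := hS.exists_mulOperator
  have hinner : ∀ {k : ℕ} (c : Fin N → Fin k → ℂ) (j l : Fin N),
      inner ℂ (kernelVec (z j) (hz j) (WithLp.toLp 2 (c j)))
        (kernelVec (z l) (hz l) (WithLp.toLp 2 (c l))) =
      (1 - z j * star (z l))⁻¹ * (star (c j) ⬝ᵥ c l) := by
    intro k c j l
    rw [inner_kernelVec]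
    simp only [eval_kernelVec (hz l) (hz j), dotProduct, Finset.mul_sum, Pi.star_apply]
    exact Finset.sum_congr rfl fun i _ => by ring
  have hnorm : ∀ {k : ℕ} (c : Fin N → Fin k → ℂ),
      ((‖∑ j, kernelVec (z j) (hz j) (WithLp.toLp 2 (c j))‖ ^ 2 : ℝ) : ℂ) =
      ∑ l, ∑ j, (1 - z j * star (z l))⁻¹ * (star (c j) ⬝ᵥ c l) := by
    intro k c
    rw [← inner_self_eq_ofReal_norm_sq, inner_sum]
    refine Finset.sum_congr rfl fun l _ => ?_
    rw [sum_inner]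
    exact Finset.sum_congr rfl fun j _ => hinner c j l
  have hle : ‖∑ j, kernelVec (z j) (hz j) (WithLp.toLp 2 ((S (z j)).conjTranspose.mulVec (c j)))‖ ^ 2
      ≤ ‖∑ j, kernelVec (z j) (hz j) (WithLp.toLp 2 (c j))‖ ^ 2 := by
    have h1 : ContinuousLinearMap.adjoint M
        (∑ j, kernelVec (z j) (hz j) (WithLp.toLp 2 (c j))) =
        ∑ j, kernelVec (z j) (hz j) (WithLp.toLp 2 ((S (z j)).conjTranspose.mulVec (c j))) := by
      rw [map_sum]
      exact Finset.sum_congr rfl fun j _ => adjoint_mulOperator_kernelVec hM (hz j) _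
    rw [← h1]
    gcongr
    refine (ContinuousLinearMap.le_opNorm _ _).trans (mul_le_of_le_one_left (norm_nonneg _) ?_)
    rw [LinearIsometryEquiv.norm_map]
    exact M.opNorm_le_bound zero_le_one fun f => by simpa using hMle f
  have hC := sub_nonneg.2 (Complex.real_le_real.2 hle)
  rw [hnorm, hnorm, ← Finset.sum_sub_distrib] at hC
  convert hC using 2 with l
  rw [← Finset.sum_sub_distrib]
  refine Finset.sum_congr rfl fun j _ => ?_
  rw [Matrix.smul_mulVec, dotProduct_smul, smul_eq_mul, ← mul_sub, Matrix.sub_mulVec,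
    Matrix.one_mulVec, dotProduct_sub, Matrix.star_mulVec, Matrix.conjTranspose_conjTranspose,
    ← Matrix.mulVec_mulVec, Matrix.dotProduct_mulVec]

section Isometry

open ContinuousLinearMap

/-- The lurking isometry. If `N` is a contraction commuting with the "shifts" `b`, `b'`, and if
`‖f‖² = ‖b f‖² + ‖ε f‖²` on both sides, then on the closure `H` of the range of the defect operator
`ρ = (1 - N†N)^{1/2}` the assignment `(ρ (b f), ε f) ↦ (ρ f, ε' (N f))` is a well defined
isometry. -/
theorem exists_isometry_of_contraction {E F U Y : Type*}
    [NormedAddCommGroup E] [InnerProductSpace ℂ E] [CompleteSpace E]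
    [NormedAddCommGroup F] [InnerProductSpace ℂ F] [CompleteSpace F]
    [NormedAddCommGroup U] [InnerProductSpace ℂ U]
    [NormedAddCommGroup Y] [InnerProductSpace ℂ Y] [CompleteSpace Y]
    (N : E →L[ℂ] F) (hN : ∀ f, ‖N f‖ ≤ ‖f‖)
    (b : E →L[ℂ] E) (ε : E →L[ℂ] U) (b' : F →L[ℂ] F) (ε' : F →L[ℂ] Y)
    (hb : ∀ f, ‖b f‖ ^ 2 + ‖ε f‖ ^ 2 = ‖f‖ ^ 2) (hb' : ∀ f, ‖b' f‖ ^ 2 + ‖ε' f‖ ^ 2 = ‖f‖ ^ 2)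
    (hsurj : ∀ g u, ∃ f, b f = g ∧ ε f = u) (hcomm : ∀ f, b' (N f) = N (b f)) :
    ∃ (H : Submodule ℂ E) (_ : CompleteSpace H) (ρ : E →L[ℂ] H)
      (V : WithLp 2 (H × U) →ₗᵢ[ℂ] WithLp 2 (H × Y)),
      ∀ f, V (WithLp.toLp 2 (ρ (b f), ε f)) = WithLp.toLp 2 (ρ f, ε' (N f)) := by
  set T : E →L[ℂ] E := 1 - adjoint N ∘L N with hT
  have hTinner : ∀ f, inner ℂ (T f) f = ((‖f‖ ^ 2 - ‖N f‖ ^ 2 : ℝ) : ℂ) := by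
    intro f
    change inner ℂ (f - adjoint N (N f)) f = _
    rw [inner_sub_left, adjoint_inner_left, inner_self_eq_ofReal_norm_sq,
      inner_self_eq_ofReal_norm_sq, Complex.ofReal_sub]
  have hTpos : 0 ≤ T := by
    rw [nonneg_iff_isPositive, isPositive_iff_complex]
    intro f
    rw [hTinner f]
    simp only [RCLike.re_to_complex, Complex.ofReal_re, true_and]
    have := hN f
    nlinarith [norm_nonneg (N f)]
  -- The defect operator.
  set R : E →L[ℂ] E := CFC.sqrt T with hR
  have hRR : R * R = T := CFC.sqrt_mul_sqrt_self T hTpos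
  have hRsa : adjoint R = R := by
    have h : 0 ≤ R := CFC.sqrt_nonneg T
    exact ((nonneg_iff_isPositive R).1 h).isSelfAdjoint.adjoint_eq
  have hRnorm : ∀ f, ‖R f‖ ^ 2 = ‖f‖ ^ 2 - ‖N f‖ ^ 2 := by
    intro f
    have h1 : inner ℂ (R f) (R f) = inner ℂ (T f) f := by
      conv_lhs => rw [← hRsa, adjoint_inner_right, hRsa]
      rw [← hRR]
      rfl
    rw [hTinner, inner_self_eq_ofReal_norm_sq] at h1
    exact_mod_cast h1
  set H : Submodule ℂ E := (LinearMap.range R.toLinearMap).topologicalClosure with hH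
  have hmem : ∀ f, R f ∈ H := fun f =>
    Submodule.le_topologicalClosure _ (LinearMap.mem_range_self R.toLinearMap f)
  have hcl : IsClosed (H : Set E) := Submodule.isClosed_topologicalClosure _
  have hHc : CompleteSpace H := hcl.completeSpace_coe
  set ρ : E →L[ℂ] H := R.codRestrict H hmem with hρ
  have hρnorm : ∀ f, ‖ρ f‖ = ‖R f‖ := fun f => rfl
  have hρdense : DenseRange ρ := by
    rw [DenseRange, Subtype.dense_iff]
    intro x hx
    have h1 : (Subtype.val '' Set.range ρ : Set E) = LinearMap.range R.toLinearMap := by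
      ext y
      simp [hρ]
    change x ∈ closure (Subtype.val '' Set.range ρ : Set E)
    rw [h1]
    exact hx
  -- The two sides of the isometry, as functions of `f`.
  set φ : E →ₗ[ℂ] WithLp 2 (H × U) := (WithLp.linearEquiv 2 ℂ (H × U)).symm.toLinearMap ∘ₗ
    ((ρ ∘L b).toLinearMap.prod ε.toLinearMap) with hφ
  set ψ : E →ₗ[ℂ] WithLp 2 (H × Y) := (WithLp.linearEquiv 2 ℂ (H × Y)).symm.toLinearMap ∘ₗ
    (ρ.toLinearMap.prod (ε' ∘L N).toLinearMap) with hψ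
  have hφa : ∀ f, φ f = WithLp.toLp 2 (ρ (b f), ε f) := fun f => rfl
  have hψa : ∀ f, ψ f = WithLp.toLp 2 (ρ f, ε' (N f)) := fun f => rfl
  have hnorm : ∀ f, ‖ψ f‖ = ‖φ f‖ := by
    intro f
    rw [← sq_eq_sq₀ (norm_nonneg _) (norm_nonneg _), hφa, hψa, WithLp.prod_norm_sq_eq_of_L2,
      WithLp.prod_norm_sq_eq_of_L2]
    change ‖R f‖ ^ 2 + ‖ε' (N f)‖ ^ 2 = ‖R (b f)‖ ^ 2 + ‖ε f‖ ^ 2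
    rw [hRnorm, hRnorm, ← hcomm, ← hb f, ← hb' (N f)]
    ring
  have hdense : DenseRange φ := by
    have h1 : DenseRange (Prod.map ρ (id : U → U)) := hρdense.prodMap denseRange_id
    have h2 : DenseRange (WithLp.toLp 2 ∘ Prod.map ρ (id : U → U)) :=
      (WithLp.toLp_surjective 2).denseRange.comp h1 (WithLp.prod_continuous_toLp 2 H U)
    refine h2.mono ?_
    rintro _ ⟨⟨g, u⟩, rfl⟩
    obtain ⟨f, hf, hu⟩ := hsurj g u
    exact ⟨f, by rw [hφa, hf, hu]; rfl⟩
  have hbound : ∃ C : ℝ, ∀ f, ‖ψ f‖ ≤ C * ‖φ f‖ := ⟨1, fun f => by rw [one_mul, hnorm]⟩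
  have hV : ∀ f, ψ.extendOfNorm φ (φ f) = ψ f := LinearMap.extendOfNorm_eq hdense hbound
  refine ⟨H, hHc, ρ, ⟨(ψ.extendOfNorm φ).toLinearMap, fun x => ?_⟩, hV⟩
  refine hdense.induction_on (p := fun x => ‖ψ.extendOfNorm φ x‖ = ‖x‖) x ?_ fun f => ?_
  · exact isClosed_eq (by fun_prop) (by fun_prop)
  · rw [hV, hnorm]

end Isometry

/-- A classical coisometric realization: a Hilbert space and an isometry `V` whose adjoint
`(A B; C D)` has transfer function `S`. The transfer function is described through the system
equations `y = z A y + B v`, `S(z) v = z C y + D v`. -/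
structure SchurRealization {n m : ℕ} (S : ℂ → Matrix (Fin n) (Fin m) ℂ) where
  /-- The state space. -/
  State : Type
  [normedAddCommGroup : NormedAddCommGroup State]
  [innerProductSpace : InnerProductSpace ℂ State]
  [completeSpace : CompleteSpace State]
  /-- The adjoint of the block operator. -/
  V : WithLp 2 (State × EuclideanSpace ℂ (Fin n)) →ₗᵢ[ℂ]
    WithLp 2 (State × EuclideanSpace ℂ (Fin m))
  transfer : ∀ z ∈ ball (0 : ℂ) 1, ∀ (y : State) (v : EuclideanSpace ℂ (Fin m)),
    y = (ContinuousLinearMap.adjoint V.toContinuousLinearMap (WithLp.toLp 2 (z • y, v))).fst →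
    (S z).mulVec v =
      (ContinuousLinearMap.adjoint V.toContinuousLinearMap (WithLp.toLp 2 (z • y, v))).snd

namespace SchurRealization

attribute [instance] normedAddCommGroup innerProductSpace completeSpace

variable {n m : ℕ} {S : ℂ → Matrix (Fin n) (Fin m) ℂ} (X : SchurRealization S)

/-- The coisometric block operator `(A B; C D)`. -/
def block : WithLp 2 (X.State × EuclideanSpace ℂ (Fin m)) →L[ℂ]
    WithLp 2 (X.State × EuclideanSpace ℂ (Fin n)) :=
  ContinuousLinearMap.adjoint X.V.toContinuousLinearMap

theorem inner_block (p : WithLp 2 (X.State × EuclideanSpace ℂ (Fin m)))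
    (q : WithLp 2 (X.State × EuclideanSpace ℂ (Fin n))) :
    inner ℂ (X.block p) q = inner ℂ p (X.V q) :=
  ContinuousLinearMap.adjoint_inner_left _ _ _

theorem block_V (q : WithLp 2 (X.State × EuclideanSpace ℂ (Fin n))) : X.block (X.V q) = q :=
  ext_inner_right ℂ fun r => by rw [inner_block, LinearIsometry.inner_map_map]

theorem norm_block_le (p : WithLp 2 (X.State × EuclideanSpace ℂ (Fin m))) :
    ‖X.block p‖ ≤ ‖p‖ := by
  refine (ContinuousLinearMap.le_opNorm _ _).trans (mul_le_of_le_one_left (norm_nonneg _) ?_)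
  rw [block, LinearIsometryEquiv.norm_map]
  exact X.V.norm_toContinuousLinearMap_le

/-- The main operator `A` of the realization. -/
def A : X.State →L[ℂ] X.State :=
  LinearMap.mkContinuous
    { toFun := fun x => (X.block (WithLp.toLp 2 (x, 0))).fst
      map_add' := fun x y => by
        have : (WithLp.toLp 2 (x + y, 0) : WithLp 2 (X.State × EuclideanSpace ℂ (Fin m))) =
          WithLp.toLp 2 (x, 0) + WithLp.toLp 2 (y, 0) := by
          rw [← WithLp.toLp_add]; simp
        rw [this, map_add, WithLp.add_fst]
      map_smul' := fun c x => by
        have : (WithLp.toLp 2 (c • x, 0) : WithLp 2 (X.State × EuclideanSpace ℂ (Fin m))) =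
          c • WithLp.toLp 2 (x, 0) := by
          rw [← WithLp.toLp_smul]; simp
        rw [this, map_smul, WithLp.smul_fst, RingHom.id_apply] } 1 fun x => by
    have h1 := X.norm_block_le (WithLp.toLp 2 (x, 0))
    rw [one_mul]
    exact (WithLp.norm_fst_le _ _).trans (h1.trans_eq (WithLp.norm_toLp_fst _ _ _ x))

theorem norm_A_le : ‖X.A‖ ≤ 1 := LinearMap.mkContinuous_norm_le _ zero_le_one _

theorem bijective_one_sub_smul_A {z : ℂ} (hz : z ∈ ball (0 : ℂ) 1) :
    Function.Bijective fun y => y - z • X.A y := by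
  have h : IsUnit (1 - z • X.A) := by
    refine isUnit_one_sub_of_norm_lt_one ?_
    rw [mem_ball_zero_iff] at hz
    rw [norm_smul]
    exact (mul_le_of_le_one_right (norm_nonneg _) X.norm_A_le).trans_lt hz
  exact ContinuousLinearMap.isUnit_iff_bijective.1 h

end SchurRealization

open HardyVec in
/-- Every Schur function has a coisometric realization: the lurking isometry for `N = M†`, where `M`
is multiplication by `S`, sends `(w̄ ρ k_w u, u)` to `(ρ k_w u, S(w)ᴴ u)` for the reproducing kernel
functions `k_w u`, which determines the transfer function of its adjoint. -/
theorem IsSchurDisk.nonempty_realization {n m : ℕ} {S : ℂ → Matrix (Fin n) (Fin m) ℂ}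
    (hS : IsSchurDisk S) : Nonempty (SchurRealization S) := by
  obtain ⟨M, hMle, hM⟩ := hS.exists_mulOperator
  have hMadj : ∀ f, ‖ContinuousLinearMap.adjoint M f‖ ≤ ‖f‖ := fun f => by
    refine (ContinuousLinearMap.le_opNorm _ _).trans (mul_le_of_le_one_left (norm_nonneg _) ?_)
    rw [LinearIsometryEquiv.norm_map]
    exact M.opNorm_le_bound zero_le_one fun f => by simpa using hMle f
  obtain ⟨H, hHc, ρ, V, hV⟩ := exists_isometry_of_contraction (ContinuousLinearMap.adjoint M) hMadj
    (backShift n) (evalZero n) (backShift m) (evalZero m) norm_sq_backShift_add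
    norm_sq_backShift_add (fun g u => ⟨cons u g, by ext; simp, by simp⟩)
    (backShift_adjoint_mulOperator hM)
  refine ⟨⟨H, V, fun z hz y v hy => ?_⟩⟩
  -- Pair the output with `u`, using the value of `V` at the reproducing kernel function at `z`.
  refine WithLp.toLp_injective 2 (ext_inner_right ℂ fun u => ?_)
  set T := ContinuousLinearMap.adjoint V.toContinuousLinearMap with hT
  set x := ρ (kernelVec z hz u) with hx
  have h1 := hV (kernelVec z hz u)
  rw [backShift_kernelVec, map_smul, evalZero_apply, evalZero_apply,
    adjoint_mulOperator_kernelVec hM hz, kernelVec_apply, kernelVec_apply, pow_zero, one_smul,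
    one_smul, ← hx] at h1
  have h2 : inner ℂ (T (WithLp.toLp 2 (z • y, v))) (WithLp.toLp 2 (star z • x, u)) =
      inner ℂ (WithLp.toLp 2 (z • y, v)) (V (WithLp.toLp 2 (star z • x, u))) :=
    ContinuousLinearMap.adjoint_inner_left _ _ _
  rw [h1, WithLp.prod_inner_apply, WithLp.prod_inner_apply] at h2
  have h3 : (T (WithLp.toLp 2 (z • y, v))).fst = y := hy.symm
  change inner ℂ (T (WithLp.toLp 2 (z • y, v))).fst (star z • x) +
    inner ℂ (T (WithLp.toLp 2 (z • y, v))).snd u = inner ℂ (z • y) x + inner ℂ v _ at h2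
  rw [h3, inner_smul_right, inner_smul_left] at h2
  have h4 := add_left_cancel h2
  refine Eq.trans ?_ h4.symm
  rw [EuclideanSpace.inner_eq_star_dotProduct, EuclideanSpace.inner_eq_star_dotProduct]
  rw [dotProduct_comm, Matrix.star_mulVec, ← Matrix.dotProduct_mulVec, dotProduct_comm]

end

/-! ### Idempotent components of bicomplex numbers and of holomorphic functions -/

noncomputable section

open Filter Topology
open scoped ComplexOrder

namespace BC

/-- The two ring homomorphisms `BC → ℂ` given by the idempotent coordinates `β₁` (index `0`) and
`β₂` (index `1`). -/
def proj (l : Fin 2) : BC →+* ℂ :=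
  if l = 0 then ⟨⟨⟨β₁, β₁_one⟩, β₁_mul⟩, β₁_zero, β₁_add⟩
  else ⟨⟨⟨β₂, β₂_one⟩, β₂_mul⟩, β₂_zero, β₂_add⟩

@[simp] theorem proj_zero (Z : BC) : proj 0 Z = Z.β₁ := rfl
@[simp] theorem proj_one (Z : BC) : proj 1 Z = Z.β₂ := rfl

/-- The bicomplex number with given idempotent coordinates. -/
def ofProj (c : Fin 2 → ℂ) : BC := ofComplex (c 0) * e + ofComplex (c 1) * eDag

@[simp] theorem proj_ofProj (c : Fin 2 → ℂ) (l : Fin 2) : proj l (ofProj c) = c l := by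
  fin_cases l
  · exact β₁_idempotent _ _
  · exact β₂_idempotent _ _

theorem ext_proj {Z W : BC} (h : ∀ l, proj l Z = proj l W) : Z = W := ext_β (h 0) (h 1)

@[simp] theorem proj_star (l : Fin 2) (Z : BC) : proj l (star Z) = star (proj l Z) := by
  fin_cases l
  · exact β₁_star Z
  · exact β₂_star Z

@[simp] theorem proj_ofComplex (l : Fin 2) (z : ℂ) : proj l (ofComplex z) = z := by
  fin_cases l <;> simp [ofComplex, β₁, β₂]

theorem mem_hypPos_iff_proj {Z : BC} : Z ∈ hypPos ↔ ∀ l, 0 ≤ proj l Z := by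
  rw [mem_hypPos_iff, Fin.forall_fin_two, proj_zero, proj_one]
  constructor
  · rintro ⟨ν, μ, h₁, h₂, hν, hμ⟩
    rw [h₁, h₂]
    exact ⟨Complex.zero_le_real.2 hν, Complex.zero_le_real.2 hμ⟩
  · rintro ⟨h₁, h₂⟩
    exact ⟨_, _, Complex.eq_re_of_ofReal_le h₁, Complex.eq_re_of_ofReal_le h₂,
      (Complex.nonneg_iff.1 h₁).1, (Complex.nonneg_iff.1 h₂).1⟩

theorem hypLE_iff_proj {Z W : BC} : hypLE Z W ↔ ∀ l, proj l Z ≤ proj l W := by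
  simp only [hypLE, mem_hypPos_iff_proj, map_sub, sub_nonneg]

theorem mem_bidisk_iff_proj {Z : BC} : Z ∈ bidisk ↔ ∀ l, proj l Z ∈ ball (0 : ℂ) 1 := by
  simp [bidisk, Fin.forall_fin_two]

theorem isUnit_iff_proj {Z : BC} : IsUnit Z ↔ ∀ l, proj l Z ≠ 0 := by
  refine ⟨fun h l => (h.map (proj l)).ne_zero, fun h => ?_⟩
  exact IsUnit.of_mul_eq_one (ofProj fun l => (proj l Z)⁻¹) (ext_proj fun l => by simp [h l])

theorem proj_inverse {Z : BC} (h : IsUnit Z) (l : Fin 2) :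
    proj l (Ring.inverse Z) = (proj l Z)⁻¹ := by
  refine eq_inv_of_mul_eq_one_left ?_
  rw [← map_mul, Ring.inverse_mul_cancel Z h, map_one]

theorem isInducing_proj : IsInducing fun (Z : BC) (l : Fin 2) => proj l Z := by
  have h0 : IsInducing fun Z : BC => (Z.z₁, Z.z₂) := ⟨rfl⟩
  have h1 : Continuous fun Z : BC => Z.z₁ := continuous_fst.comp h0.continuous
  have h2 : Continuous fun Z : BC => Z.z₂ := continuous_snd.comp h0.continuous
  refine IsInducing.of_comp (g := fun c : Fin 2 → ℂ =>
    ((c 0 + c 1) / 2, Complex.I * (c 0 - c 1) / 2)) ?_ (by fun_prop) ?_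
  · refine continuous_pi fun l => ?_
    fin_cases l
    · exact h1.sub (continuous_const.mul h2)
    · exact h1.add (continuous_const.mul h2)
  · convert h0 using 2 with Z
    simp only [Function.comp, proj_zero, proj_one, β₁, β₂, Prod.mk.injEq]
    constructor
    · ring
    · linear_combination (-Z.z₂) * Complex.I_sq

theorem continuous_proj (l : Fin 2) : Continuous (proj l) :=
  (continuous_apply l).comp isInducing_proj.continuous

theorem continuous_ofProj : Continuous ofProj := by
  rw [isInducing_proj.continuous_iff]
  refine continuous_pi fun l => ?_
  simpa [Function.comp_def] using continuous_apply l

theorem hasSum_iff_proj {ι : Type*} {f : ι → BC} {Z : BC} :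
    HasSum f Z ↔ ∀ l, HasSum (fun i => proj l (f i)) (proj l Z) := by
  have h := isInducing_proj.hasSum_iff (L := .unconditional ι) (g := RingHom.pi proj) f Z
  rw [← h, Pi.hasSum]
  rfl

theorem summable_iff_proj {ι : Type*} {f : ι → BC} :
    Summable f ↔ ∀ l, Summable fun i => proj l (f i) := by
  refine ⟨fun ⟨Z, h⟩ l => ⟨_, hasSum_iff_proj.1 h l⟩, fun h => ?_⟩
  exact ⟨ofProj fun l => ∑' i, proj l (f i), hasSum_iff_proj.2 fun l => by
    rw [proj_ofProj]; exact (h l).hasSum⟩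

instance : T2Space BC := by
  refine T2Space.of_injective_continuous (f := fun (Z : BC) (l : Fin 2) => proj l Z) ?_
    isInducing_proj.continuous
  exact fun Z W h => ext_proj fun l => congrFun h l

theorem proj_tsum {ι : Type*} {f : ι → BC} (h : Summable f) (l : Fin 2) :
    proj l (∑' i, f i) = ∑' i, proj l (f i) :=
  (hasSum_iff_proj.1 h.hasSum l).tsum_eq.symm

end BC

/-- If the partial difference quotients of `G` in the first variable converge when both variables
move (off the axes), then `G` does not depend on the second variable and is holomorphic in the
first. -/
theorem eq_and_differentiableOn_of_tendsto_quotient {G : ℂ → ℂ → ℂ}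
    (hG : ∀ a ∈ ball (0 : ℂ) 1, ∀ b ∈ ball (0 : ℂ) 1, ∃ L, Tendsto
      (fun p : ℂ × ℂ => (G (a + p.1) (b + p.2) - G a b) * p.1⁻¹) (𝓝[≠] 0 ×ˢ 𝓝[≠] 0) (𝓝 L)) :
    (∀ a ∈ ball (0 : ℂ) 1, ∀ b ∈ ball (0 : ℂ) 1, G a b = G a 0) ∧
      DifferentiableOn ℂ (fun a => G a 0) (ball 0 1) := by
  have hbound : ∀ a ∈ ball (0 : ℂ) 1, ∀ b ∈ ball (0 : ℂ) 1, ∃ C : ℝ,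
      ∀ᶠ p : ℂ × ℂ in 𝓝[≠] 0 ×ˢ 𝓝[≠] 0, ‖G (a + p.1) (b + p.2) - G a b‖ ≤ C * ‖p.1‖ := by
    intro a ha b hb
    obtain ⟨L, hL⟩ := hG a ha b hb
    refine ⟨‖L‖ + 1, ?_⟩
    have h1 := hL.norm.eventually (gt_mem_nhds (lt_add_one ‖L‖))
    have h2 : ∀ᶠ p : ℂ × ℂ in 𝓝[≠] 0 ×ˢ 𝓝[≠] 0, p.1 ≠ 0 :=
      tendsto_fst.eventually self_mem_nhdsWithin
    filter_upwards [h1, h2] with p hp hp0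
    rw [norm_mul, norm_inv, ← div_eq_mul_inv, div_lt_iff₀ (norm_pos_iff.2 hp0)] at hp
    exact hp.le
  -- Compare the increments at `(a, b)` and at `(a, b + k)`.
  have hloc : ∀ a ∈ ball (0 : ℂ) 1, ∀ b ∈ ball (0 : ℂ) 1, ∀ᶠ k in 𝓝[≠] (0 : ℂ),
      G a (b + k) = G a b := by
    intro a ha b hb
    obtain ⟨C, hC⟩ := hbound a ha b hb
    obtain ⟨p, hp, q, hq, hpq⟩ := eventually_prod_iff.1 hC
    have hq' : ∀ᶠ k in 𝓝[≠] (0 : ℂ), ∀ᶠ k' in 𝓝 k, q k' :=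
      eventually_nhdsNE_eventually_nhds_iff.2 hq
    have hb' : ∀ᶠ k in 𝓝[≠] (0 : ℂ), b + k ∈ ball (0 : ℂ) 1 := by
      refine (ContinuousAt.eventually_mem (f := fun k : ℂ => b + k) (x := 0) (by fun_prop)
        ?_).filter_mono nhdsWithin_le_nhds
      rw [add_zero]
      exact isOpen_ball.mem_nhds hb
    filter_upwards [hq', hb'] with k hk hbk
    obtain ⟨C', hC'⟩ := hbound a ha (b + k) hbk
    obtain ⟨p', hp', q', hq', hpq'⟩ := eventually_prod_iff.1 hC'
    have hk' : ∀ᶠ j in 𝓝[≠] (0 : ℂ), q (k + j) := by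
      have : Tendsto (fun j : ℂ => k + j) (𝓝[≠] 0) (𝓝 k) := by
        refine (Continuous.tendsto' (by fun_prop) 0 k (add_zero k)).mono_left nhdsWithin_le_nhds
      exact this.eventually hk
    obtain ⟨j, hj, hjq⟩ := (hk'.and hq').exists
    have hle : ∀ᶠ h in 𝓝[≠] (0 : ℂ), ‖G a (b + k) - G a b‖ ≤ C' * ‖h‖ + C * ‖h‖ := by
      filter_upwards [hp, hp'] with h h1 h2
      have e1 := hpq h1 hj
      have e2 := hpq' h2 hjq
      simp only [← add_assoc] at e1 e2
      calc ‖G a (b + k) - G a b‖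
          = ‖(G (a + h) (b + k + j) - G a b) - (G (a + h) (b + k + j) - G a (b + k))‖ := by
            congr 1; ring
        _ ≤ _ := (norm_sub_le _ _).trans (by linarith)
    have hlim : Tendsto (fun h : ℂ => C' * ‖h‖ + C * ‖h‖) (𝓝[≠] 0) (𝓝 0) :=
      (Continuous.tendsto' (by fun_prop) 0 0 (by simp)).mono_left nhdsWithin_le_nhds
    have := ge_of_tendsto hlim hle
    exact sub_eq_zero.1 (norm_le_zero_iff.1 this)
  have hconst : ∀ a ∈ ball (0 : ℂ) 1, ∀ b ∈ ball (0 : ℂ) 1, G a b = G a 0 := by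
    intro a ha b hb
    have hd : ∀ b ∈ ball (0 : ℂ) 1, HasDerivAt (G a) 0 b := by
      intro b hb
      rw [hasDerivAt_iff_tendsto_slope_zero]
      refine tendsto_const_nhds.congr' ?_
      filter_upwards [hloc a ha b hb] with k hk
      simp [hk]
    exact isOpen_ball.is_const_of_deriv_eq_zero (convex_ball _ _).isPreconnected
      (fun b hb => (hd b hb).differentiableAt.differentiableWithinAt)
      (fun b hb => (hd b hb).deriv) hb (mem_ball_self one_pos)
  refine ⟨hconst, fun a ha => ?_⟩
  obtain ⟨L, hL⟩ := hG a ha 0 (mem_ball_self one_pos)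
  have hda : HasDerivAt (fun a => G a 0) L a := by
    rw [hasDerivAt_iff_tendsto_slope_zero]
    have hdiag : Tendsto (fun h : ℂ => (h, h)) (𝓝[≠] 0) (𝓝[≠] 0 ×ˢ 𝓝[≠] 0) :=
      tendsto_id.prodMk tendsto_id
    have hah : ∀ᶠ h in 𝓝[≠] (0 : ℂ), a + h ∈ ball (0 : ℂ) 1 := by
      refine (ContinuousAt.eventually_mem (f := fun k : ℂ => a + k) (x := 0) (by fun_prop)
        ?_).filter_mono nhdsWithin_le_nhds
      rw [add_zero]
      exact isOpen_ball.mem_nhds ha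
    have hh : ∀ᶠ h in 𝓝[≠] (0 : ℂ), h ∈ ball (0 : ℂ) 1 :=
      (isOpen_ball.mem_nhds (mem_ball_self one_pos) :
        ball (0 : ℂ) 1 ∈ 𝓝 0) |> mem_nhdsWithin_of_mem_nhds
    refine (hL.comp hdiag).congr' ?_
    filter_upwards [hah, hh] with h h1 h2
    simp only [Function.comp, zero_add, smul_eq_mul]
    rw [hconst _ h1 _ h2, mul_comm]
  exact hda.differentiableAt.differentiableWithinAt

namespace BC

/-- A function derivable at each point of the bidisk splits into two holomorphic functions of one
idempotent coordinate each. -/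
theorem exists_split_of_derivableAt {F : BC → BC} (hF : ∀ Z ∈ bidisk, DerivableAt F Z)
    (l : Fin 2) : ∃ g : ℂ → ℂ, DifferentiableOn ℂ g (ball 0 1) ∧
      ∀ Z ∈ bidisk, proj l (F Z) = g (proj l Z) := by
  -- The bicomplex number with `l`-th coordinate `a` and the other coordinate `b`.
  set pt : ℂ → ℂ → BC := fun a b => ofProj (Function.update (fun _ => b) l a) with hpt
  have hpt0 : pt 0 0 = 0 := ext_proj fun l' => by simp [hpt]
  have hcont : Continuous fun p : ℂ × ℂ => pt p.1 p.2 := by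
    refine continuous_ofProj.comp (continuous_pi fun l' => ?_)
    by_cases h : l' = l
    · simpa [Function.update_apply, h] using continuous_fst
    · simpa [Function.update_apply, h] using continuous_snd
  have hadd : ∀ a b h k, pt (a + h) (b + k) = pt a b + pt h k := fun a b h k =>
    ext_proj fun l' => by
      by_cases h : l' = l <;> simp [hpt, h]
  obtain ⟨h1, h2⟩ := eq_and_differentiableOn_of_tendsto_quotient
    (G := fun a b => proj l (F (pt a b))) (by
    intro a ha b hb
    obtain ⟨L, hL⟩ := hF (pt a b) (mem_bidisk_iff_proj.2 fun l' => by
      by_cases h : l' = l <;> simp only [hpt, proj_ofProj, Function.update_apply, h, if_true,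
        if_false, ha, hb])
    have hne : ∀ᶠ p : ℂ × ℂ in 𝓝[≠] 0 ×ˢ 𝓝[≠] 0, IsUnit (pt p.1 p.2) := by
      have e1 : ∀ᶠ p : ℂ × ℂ in 𝓝[≠] 0 ×ˢ 𝓝[≠] 0, p.1 ≠ 0 :=
        tendsto_fst.eventually self_mem_nhdsWithin
      have e2 : ∀ᶠ p : ℂ × ℂ in 𝓝[≠] 0 ×ˢ 𝓝[≠] 0, p.2 ≠ 0 :=
        tendsto_snd.eventually self_mem_nhdsWithin
      filter_upwards [e1, e2] with p hp1 hp2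
      refine isUnit_iff_proj.2 fun l' => ?_
      by_cases h : l' = l <;> simp [hpt, h, hp1, hp2]
    have htend : Tendsto (fun p : ℂ × ℂ => pt p.1 p.2) (𝓝[≠] 0 ×ˢ 𝓝[≠] 0)
        (𝓝[{H : BC | IsUnit H}] 0) := by
      refine tendsto_nhdsWithin_iff.2 ⟨?_, hne⟩
      have : (𝓝[≠] 0 ×ˢ 𝓝[≠] 0 : Filter (ℂ × ℂ)) ≤ 𝓝 (0, 0) := by
        rw [nhds_prod_eq]
        exact Filter.prod_mono nhdsWithin_le_nhds nhdsWithin_le_nhds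
      exact (hcont.tendsto' (0, 0) 0 hpt0).mono_left this
    refine ⟨proj l L, (((continuous_proj l).tendsto L).comp (hL.comp htend)).congr' ?_⟩
    filter_upwards [hne] with p hp
    simp only [Function.comp]
    rw [map_mul, map_sub, proj_inverse hp, ← hadd]
    simp [hpt])
  refine ⟨_, h2, fun Z hZ => ?_⟩
  rw [mem_bidisk_iff_proj] at hZ
  -- The remaining coordinate of `Z` has index `l + 1`.
  have hZpt : Z = pt (proj l Z) (proj (l + 1) Z) := ext_proj fun l' => by
    by_cases h : l' = l
    · simp [hpt, h]
    · have : l' = l + 1 := by omega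
      subst this
      simp [hpt]
  rw [← h1 _ (hZ l) _ (hZ (l + 1)), ← hZpt]

end BC

end

/-! ### Bicomplex Hilbert modules and bicomplex realizations -/

noncomputable section

section InnerProductModule

variable {X Y : Type*} [AddCommGroup X] [Module BC X] [BCInnerProductModule X]
  [AddCommGroup Y] [Module BC Y] [BCInnerProductModule Y]

theorem bcInner_star (x y : X) : star (bcInner x y) = bcInner y x :=
  (BCInnerProductModule.inner_conj_symm y x).symm

theorem bcInner_add_right (x y z : X) : bcInner x (y + z) = bcInner x y + bcInner x z :=
  BCInnerProductModule.inner_add_right x y z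

theorem bcInner_smul_left (μ : BC) (x y : X) : bcInner (μ • x) y = μ * bcInner x y :=
  BCInnerProductModule.inner_smul_left μ x y

theorem bcInner_add_left (x y z : X) : bcInner (x + y) z = bcInner x z + bcInner y z := by
  rw [← bcInner_star, bcInner_add_right, star_add, bcInner_star, bcInner_star]

theorem bcInner_smul_right (μ : BC) (x y : X) : bcInner x (μ • y) = star μ * bcInner x y := by
  rw [← bcInner_star, bcInner_smul_left, star_mul, bcInner_star, mul_comm]

theorem bcInner_sub_sub (x y : X) :
    bcInner (x - y) (x - y) = bcInner x x - bcInner x y - bcInner y x + bcInner y y := by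
  have h : x - y = x + (-1 : BC) • y := by rw [neg_smul, one_smul, sub_eq_add_neg]
  rw [h, bcInner_add_left, bcInner_add_right, bcInner_add_right, bcInner_smul_left,
    bcInner_smul_left, bcInner_smul_right, bcInner_smul_right]
  simp
  ring

/-- A coisometry is a contraction: `⟨p, p⟩ - ⟨T p, T p⟩ = ⟨p - q, p - q⟩` for `q = T♯ T p`. -/
theorem bcInner_map_le_of_coisometric {T : X →ₗ[BC] Y} (hT : IsCoisometric T) (p : X) :
    hypLE (bcInner (T p) (T p)) (bcInner p p) := by
  obtain ⟨-, S, hS, hTS⟩ := hT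
  have hTS' : ∀ y, T (S y) = y := fun y => LinearMap.congr_fun hTS y
  have h1 : bcInner p (S (T p)) = bcInner (T p) (T p) := (hS p (T p)).symm
  have h2 : bcInner (S (T p)) p = bcInner (T p) (T p) := by
    rw [← bcInner_star, h1, bcInner_star]
  have h3 : bcInner (S (T p)) (S (T p)) = bcInner (T p) (T p) := by
    rw [← hS, hTS']
  have h4 := BCInnerProductModule.inner_self_mem (p - S (T p))
  change bcInner _ _ ∈ hypPos at h4
  rw [bcInner_sub_sub, h1, h2, h3] at h4
  simpa [hypLE] using h4

open scoped ComplexOrder in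
/-- The transfer function of a coisometric realization is contractive: the block operator maps
`(Z x, v)` to `(x, s(Z) v)` for `x = (1 - Z A)⁻¹ B v`. -/
theorem HasCoisometricRealization.bcInner_mulVec_le {n m : ℕ}
    {s : BC → Matrix (Fin n) (Fin m) BC} (h : HasCoisometricRealization.{u} s) {Z : BC}
    (hZ : Z ∈ bidisk) (v : Fin m → BC) :
    hypLE (bcInner ((s Z).mulVec v) ((s Z).mulVec v)) (bcInner v v) := by
  obtain ⟨H, _, _, _, -, A, B, C, D, hT, hreal⟩ := h
  obtain ⟨hunit, hs⟩ := hreal Z hZ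
  set x : H := Ring.inverse ((1 : Module.End BC H) - Z • A) (B v) with hx
  have hx1 : x - Z • A x = B v := by
    have := LinearMap.congr_fun (Ring.mul_inverse_cancel _ hunit) (B v)
    simpa using this
  have hsv : (s Z).mulVec v = D v + Z • C x := by
    have := LinearMap.congr_fun hs v
    simpa using this
  have hTp : ((A.coprod B).prod (C.coprod D)) (Z • x, v) = (x, (s Z).mulVec v) := by
    rw [hsv]
    simp [← hx1, add_comm]
  have hle := bcInner_map_le_of_coisometric hT (Z • x, v)
  rw [hTp] at hle
  change hypLE (bcInner x x + bcInner ((s Z).mulVec v) ((s Z).mulVec v))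
    (bcInner (Z • x) (Z • x) + bcInner v v) at hle
  rw [bcInner_smul_left, bcInner_smul_right] at hle
  have hxx : bcInner x x ∈ hypPos := BCInnerProductModule.inner_self_mem x
  rw [hypLE_iff_proj] at hle ⊢
  rw [mem_hypPos_iff_proj] at hxx
  rw [mem_bidisk_iff_proj] at hZ
  intro l
  have h1 := hle l
  simp only [map_add, map_mul, proj_star] at h1
  have h2 : proj l Z * (star (proj l Z) * proj l (bcInner x x)) ≤ proj l (bcInner x x) := by
    rw [← mul_assoc, Complex.star_def, Complex.mul_conj, Complex.normSq_eq_norm_sq]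
    refine mul_le_of_le_one_left (hxx l) ?_
    have h3 := mem_ball_zero_iff.1 (hZ l)
    exact_mod_cast (pow_le_one₀ (norm_nonneg _) h3.le : ‖proj l Z‖ ^ 2 ≤ 1)
  have h4 := h1.trans (add_le_add_left h2 _)
  exact le_of_add_le_add_left h4

end InnerProductModule

theorem WithLp.prod_ext {α β : Type*} {x y : WithLp 2 (α × β)} (h₁ : x.fst = y.fst)
    (h₂ : x.snd = y.snd) : x = y :=
  WithLp.ofLp_injective 2 (Prod.ext h₁ h₂)

/-- The direct sum `H₀ 𝐞 + H₁ 𝐞†` of two complex Hilbert spaces as a bicomplex module; it is placed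
in an arbitrary universe. -/
def BCSum (H : Fin 2 → Type) : Type u := ULift.{u} (∀ l, H l)

namespace BCSum

variable {H : Fin 2 → Type} {n m : ℕ}

/-- The components of an element. -/
def coord (l : Fin 2) (x : BCSum.{u} H) : H l := ULift.down x l

/-- The element with given components. -/
def mk (x : ∀ l, H l) : BCSum.{u} H := ULift.up x

@[simp] theorem coord_mk (x : ∀ l, H l) (l : Fin 2) : coord l (mk.{u} x) = x l := rfl

theorem ext_coord {x y : BCSum.{u} H} (h : ∀ l, coord l x = coord l y) : x = y :=
  ULift.ext _ _ (funext h)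

/-- The idempotent components of an element of `(H₀ 𝐞 + H₁ 𝐞†) ⊕ BCⁿ`. -/
def pairCoord (l : Fin 2) (p : BCSum.{u} H × (Fin n → BC)) :
    WithLp 2 (H l × EuclideanSpace ℂ (Fin n)) :=
  WithLp.toLp 2 (coord l p.1, WithLp.toLp 2 fun i => proj l (p.2 i))

theorem ext_pairCoord {p q : BCSum.{u} H × (Fin n → BC)}
    (h : ∀ l, pairCoord l p = pairCoord l q) : p = q := by
  refine Prod.ext (ext_coord fun l => ?_) (funext fun i => ext_proj fun l => ?_)
  · exact congrArg WithLp.fst (h l)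
  · exact congrArg (fun r : WithLp 2 (H l × EuclideanSpace ℂ (Fin n)) => r.snd i) (h l)

variable [∀ l, NormedAddCommGroup (H l)]

instance : AddCommGroup (BCSum.{u} H) := inferInstanceAs (AddCommGroup (ULift.{u} (∀ l, H l)))

@[simp] theorem coord_add (l : Fin 2) (x y : BCSum.{u} H) :
    coord l (x + y) = coord l x + coord l y := rfl

@[simp] theorem coord_sub (l : Fin 2) (x y : BCSum.{u} H) :
    coord l (x - y) = coord l x - coord l y := rfl

@[simp] theorem coord_zero (l : Fin 2) : coord l (0 : BCSum.{u} H) = 0 := rfl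

variable [∀ l, InnerProductSpace ℂ (H l)]

instance : Module BC (BCSum.{u} H) where
  smul Z x := mk fun l => proj l Z • coord l x
  one_smul x := ext_coord fun l => by
    change proj l 1 • coord l x = _
    rw [map_one, one_smul]
  mul_smul Z W x := ext_coord fun l => by
    change proj l (Z * W) • coord l x = proj l Z • proj l W • coord l x
    rw [map_mul, mul_smul]
  smul_zero Z := ext_coord fun l => smul_zero (proj l Z)
  smul_add Z x y := ext_coord fun l => smul_add (proj l Z) (coord l x) (coord l y)
  add_smul Z W x := ext_coord fun l => by
    change proj l (Z + W) • coord l x = proj l Z • coord l x + proj l W • coord l x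
    rw [map_add, add_smul]
  zero_smul x := ext_coord fun l => by
    change proj l 0 • coord l x = 0
    rw [map_zero, zero_smul]

@[simp] theorem coord_smul (l : Fin 2) (Z : BC) (x : BCSum.{u} H) :
    coord l (Z • x) = proj l Z • coord l x := rfl

open scoped ComplexOrder in
/-- The arguments are swapped because the bicomplex inner product is linear in the first one. -/
instance : BCInnerProductModule (BCSum.{u} H) where
  inner x y := ofProj fun l => inner ℂ (coord l y) (coord l x)
  inner_add_right x y z := ext_proj fun l => by simp
  inner_smul_left μ x y := ext_proj fun l => by simp
  inner_conj_symm x y := ext_proj fun l => by simp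
  inner_self_mem x := mem_hypPos_iff_proj.2 fun l => by
    rw [proj_ofProj, inner_self_eq_ofReal_norm_sq]
    exact Complex.zero_le_real.2 (by positivity)
  inner_self_eq_zero x := by
    constructor
    · intro h
      refine ext_coord fun l => ?_
      have h1 := congrArg (proj l) h
      rw [proj_ofProj, map_zero] at h1
      exact inner_self_eq_zero.1 h1
    · rintro rfl
      exact ext_proj fun l => by simp

theorem proj_bcInner (l : Fin 2) (x y : BCSum.{u} H) :
    proj l (bcInner x y) = inner ℂ (coord l y) (coord l x) :=
  proj_ofProj (fun l => inner ℂ (coord l y) (coord l x)) l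

theorem euclNorm_eq (x : BCSum.{u} H) :
    euclNorm x = √((‖coord 0 x‖ ^ 2 + ‖coord 1 x‖ ^ 2) / 2) := by
  rw [euclNorm, ← proj_zero, ← proj_one, proj_bcInner, proj_bcInner,
    inner_self_eq_ofReal_norm_sq, inner_self_eq_ofReal_norm_sq, Complex.ofReal_re,
    Complex.ofReal_re]

theorem norm_coord_le (l : Fin 2) (x : BCSum.{u} H) : ‖coord l x‖ ≤ 2 * euclNorm x := by
  refine le_of_sq_le_sq ?_ (by rw [euclNorm]; positivity)
  rw [euclNorm_eq, mul_pow, Real.sq_sqrt (by positivity)]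
  fin_cases l
  · change ‖coord 0 x‖ ^ 2 ≤ _
    linarith [sq_nonneg ‖coord 0 x‖, sq_nonneg ‖coord 1 x‖]
  · change ‖coord 1 x‖ ^ 2 ≤ _
    linarith [sq_nonneg ‖coord 0 x‖, sq_nonneg ‖coord 1 x‖]

theorem euclNorm_lt {x : BCSum.{u} H} {r : ℝ} (h : ∀ l, ‖coord l x‖ < r) : euclNorm x < r := by
  have hr : 0 < r := (norm_nonneg _).trans_lt (h 0)
  rw [euclNorm_eq, Real.sqrt_lt' hr]
  have h0 := pow_lt_pow_left₀ (h 0) (norm_nonneg _) two_ne_zero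
  have h1 := pow_lt_pow_left₀ (h 1) (norm_nonneg _) two_ne_zero
  linarith

theorem isBCHilbert [∀ l, CompleteSpace (H l)] : IsBCHilbert (BCSum.{u} H) := by
  intro w hw
  have hlim : ∀ l, ∃ x : H l, Filter.Tendsto (fun p => coord l (w p)) Filter.atTop (nhds x) := by
    intro l
    refine cauchySeq_tendsto_of_complete (Metric.cauchySeq_iff.2 fun r hr => ?_)
    obtain ⟨N, hN⟩ := hw (r / 2) (by positivity)
    refine ⟨N, fun p hp q hq => ?_⟩
    rw [dist_eq_norm, ← coord_sub]
    linarith [norm_coord_le l (w p - w q), hN p hp q hq]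
  choose x hx using hlim
  refine ⟨mk x, fun r hr => ?_⟩
  have h : ∀ᶠ p in Filter.atTop, ∀ l, ‖coord l (w p) - x l‖ < r :=
    Filter.eventually_all.2 fun l => by
      simpa [dist_eq_norm] using (Metric.tendsto_nhds.1 (hx l) r hr)
  obtain ⟨N, hN⟩ := Filter.eventually_atTop.1 h
  exact ⟨N, fun p hp => euclNorm_lt fun l => by simpa using hN p hp l⟩

theorem proj_bcInner_pair (l : Fin 2) (p q : BCSum.{u} H × (Fin n → BC)) :
    proj l (bcInner p q) = inner ℂ (pairCoord l q) (pairCoord l p) := by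
  change proj l (bcInner p.1 q.1 + ∑ i, p.2 i * star (q.2 i)) = _
  rw [map_add, proj_bcInner, WithLp.prod_inner_apply, map_sum, PiLp.inner_apply]
  simp [pairCoord]

/-- A pair of complex linear maps, acting on the idempotent components. -/
def lift (Φ : ∀ l, WithLp 2 (H l × EuclideanSpace ℂ (Fin n)) →ₗ[ℂ]
    WithLp 2 (H l × EuclideanSpace ℂ (Fin m))) :
    BCSum.{u} H × (Fin n → BC) →ₗ[BC] BCSum.{u} H × (Fin m → BC) where
  toFun p := (mk fun l => (Φ l (pairCoord l p)).fst,
    fun i => ofProj fun l => (Φ l (pairCoord l p)).snd i)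
  map_add' p q := by
    have h : ∀ l, pairCoord l (p + q) = pairCoord l p + pairCoord l q := fun l => by
      refine WithLp.prod_ext rfl ?_
      ext
      simp [pairCoord]
    refine Prod.ext (ext_coord fun l => ?_) (funext fun i => ext_proj fun l => ?_)
    · simp [h]
    · simp [h]
  map_smul' Z p := by
    have h : ∀ l, pairCoord l (Z • p) = proj l Z • pairCoord l p := fun l => by
      refine WithLp.prod_ext rfl ?_
      ext
      simp [pairCoord]
    refine Prod.ext (ext_coord fun l => ?_) (funext fun i => ext_proj fun l => ?_)
    · simp [h]
    · simp [h]

@[simp] theorem pairCoord_lift (Φ : ∀ l, WithLp 2 (H l × EuclideanSpace ℂ (Fin n)) →ₗ[ℂ]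
    WithLp 2 (H l × EuclideanSpace ℂ (Fin m))) (l : Fin 2) (p : BCSum.{u} H × (Fin n → BC)) :
    pairCoord l (lift Φ p) = Φ l (pairCoord l p) := by
  refine WithLp.prod_ext rfl ?_
  ext
  simp [lift, pairCoord]

end BCSum

open BCSum in
open scoped ComplexOrder in
/-- Classical realizations of the two components give a bicomplex realization. -/
theorem hasCoisometricRealization_of_components {n m : ℕ} {s : BC → Matrix (Fin n) (Fin m) BC}
    {S : Fin 2 → ℂ → Matrix (Fin n) (Fin m) ℂ}
    (hsS : ∀ Z ∈ bidisk, ∀ l i j, proj l (s Z i j) = S l (proj l Z) i j)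
    (X : ∀ l, SchurRealization (S l)) : HasCoisometricRealization.{u} s := by
  set T : BCSum.{u} (fun l => (X l).State) × (Fin m → BC) →ₗ[BC]
      BCSum.{u} (fun l => (X l).State) × (Fin n → BC) :=
    lift fun l => (X l).block.toLinearMap with hT
  set T' : BCSum.{u} (fun l => (X l).State) × (Fin n → BC) →ₗ[BC]
      BCSum.{u} (fun l => (X l).State) × (Fin m → BC) :=
    lift fun l => (X l).V.toLinearMap with hT'
  have hTc : ∀ l p, pairCoord l (T p) = (X l).block (pairCoord l p) := fun l p => by
    rw [hT, pairCoord_lift]; rfl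
  have hTc' : ∀ l p, pairCoord l (T' p) = (X l).V (pairCoord l p) := fun l p => by
    rw [hT', pairCoord_lift]; rfl
  set A := LinearMap.fst BC _ _ ∘ₗ T ∘ₗ LinearMap.inl BC _ _ with hA
  set B := LinearMap.fst BC _ _ ∘ₗ T ∘ₗ LinearMap.inr BC _ _ with hB
  set C := LinearMap.snd BC _ _ ∘ₗ T ∘ₗ LinearMap.inl BC _ _ with hC
  set D := LinearMap.snd BC _ _ ∘ₗ T ∘ₗ LinearMap.inr BC _ _ with hD
  have hblock : (A.coprod B).prod (C.coprod D) = T := by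
    refine LinearMap.ext fun p => ?_
    have hp : T p = T (p.1, 0) + T (0, p.2) := by rw [← map_add]; simp
    rw [hp]
    rfl
  have hcoordA : ∀ l y, coord l (A y) = (X l).A (coord l y) := fun l y => by
    have h := congrArg WithLp.fst (hTc l (y, 0))
    have h0 : pairCoord l ((y, 0) : BCSum.{u} (fun l => (X l).State) × (Fin m → BC)) =
        WithLp.toLp 2 (coord l y, 0) := by
      refine WithLp.prod_ext rfl ?_
      ext
      simp [pairCoord]
    rw [h0] at h
    exact h
  refine ⟨BCSum.{u} (fun l => (X l).State), inferInstance, inferInstance, inferInstance,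
    isBCHilbert, A, B, C, D, ?_, fun Z hZ => ?_⟩
  · rw [hblock]
    refine ⟨⟨1, mem_hypPos_iff_proj.2 fun l => by simp, fun p => ?_⟩, T', fun p q => ?_, ?_⟩
    · rw [hypLE_iff_proj, one_mul]
      have hproj : ∀ {k : ℕ} (l : Fin 2) (p : BCSum.{u} (fun l => (X l).State) × (Fin k → BC)),
          proj l (hypNorm p) = ((‖pairCoord l p‖ : ℝ) : ℂ) := by
        intro k l p
        have h1 : proj l (hypNorm p) = ((√(proj l (bcInner p p)).re : ℝ) : ℂ) := by
          fin_cases l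
          · exact β₁_idempotent _ _
          · exact β₂_idempotent _ _
        rw [h1, proj_bcInner_pair, inner_self_eq_ofReal_norm_sq, Complex.ofReal_re,
          Real.sqrt_sq (norm_nonneg _)]
      intro l
      rw [hproj, hproj, hTc]
      exact Complex.real_le_real.2 ((X l).norm_block_le _)
    · refine ext_proj fun l => ?_
      rw [proj_bcInner_pair, proj_bcInner_pair, hTc, hTc', ← inner_conj_symm,
        (X l).inner_block, inner_conj_symm]
    · refine LinearMap.ext fun q => ext_pairCoord fun l => ?_
      rw [LinearMap.comp_apply, hTc, hTc', (X l).block_V]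
      rfl
  · have hZl := mem_bidisk_iff_proj.1 hZ
    have hcoord : ∀ l y, coord l (((1 : Module.End BC (BCSum.{u} fun l => (X l).State)) - Z • A) y) =
        coord l y - proj l Z • (X l).A (coord l y) := fun l y => by
      rw [← hcoordA]; rfl
    have hunit : IsUnit ((1 : Module.End BC (BCSum.{u} fun l => (X l).State)) - Z • A) := by
      rw [Module.End.isUnit_iff]
      constructor
      · intro x y hxy
        refine ext_coord fun l => ((X l).bijective_one_sub_smul_A (hZl l)).1 ?_
        have := congrArg (coord l) hxy
        rwa [hcoord, hcoord] at this
      · intro x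
        choose y hy using fun l => ((X l).bijective_one_sub_smul_A (hZl l)).2 (coord l x)
        exact ⟨mk y, ext_coord fun l => by rw [hcoord]; exact hy l⟩
    refine ⟨hunit, LinearMap.ext fun v => ?_⟩
    set y := Ring.inverse ((1 : Module.End BC (BCSum.{u} fun l => (X l).State)) - Z • A) (B v)
      with hy
    have hy1 : y - Z • A y = B v :=
      LinearMap.congr_fun (Ring.mul_inverse_cancel _ hunit) (B v)
    change (s Z).mulVec v = D v + Z • C y
    have hTp : T (Z • y, v) = (y, D v + Z • C y) := by
      rw [← hblock]
      refine Prod.ext ?_ ?_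
      · change A (Z • y) + B v = y
        rw [map_smul, ← hy1, add_sub_cancel]
      · change C (Z • y) + D v = D v + Z • C y
        rw [map_smul, add_comm]
    funext i
    refine ext_proj fun l => ?_
    have h1 := hTc l (Z • y, v)
    rw [hTp] at h1
    have h2 := (X l).transfer (proj l Z) (hZl l) (coord l y)
      (WithLp.toLp 2 fun j => proj l (v j)) (congrArg WithLp.fst h1)
    have h3 := congrArg (fun r : WithLp 2 ((X l).State × EuclideanSpace ℂ (Fin n)) => r.snd i) h1
    refine Eq.trans ?_ ((congrFun h2 i).trans h3.symm)
    simp [Matrix.mulVec, dotProduct, hsS Z hZ]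

end

/-! ### The equivalences in idempotent components -/

noncomputable section

open scoped ComplexOrder

open scoped Matrix.Norms.L2Operator in
/-- The operator norm bound in coordinates. -/
theorem l2_opNorm_le_one_iff {n m : ℕ} (A : Matrix (Fin n) (Fin m) ℂ) :
    ‖A‖ ≤ 1 ↔ ∀ v : Fin m → ℂ, ∑ i, ‖A.mulVec v i‖ ^ 2 ≤ ∑ j, ‖v j‖ ^ 2 := by
  have h : ∀ v : Fin m → ℂ, ∑ i, ‖A.mulVec v i‖ ^ 2 ≤ ∑ j, ‖v j‖ ^ 2 ↔
      ‖Matrix.toEuclideanLin A (WithLp.toLp 2 v)‖ ≤ ‖(WithLp.toLp 2 v : EuclideanSpace ℂ (Fin m))‖ := by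
    intro v
    rw [← sq_le_sq₀ (norm_nonneg _) (norm_nonneg _), EuclideanSpace.norm_sq_eq,
      EuclideanSpace.norm_sq_eq]
    rfl
  simp only [h]
  rw [Matrix.l2_opNorm_def]
  constructor
  · intro hA v
    exact (ContinuousLinearMap.le_opNorm (LinearMap.toContinuousLinearMap
      (Matrix.toEuclideanLin A)) _).trans (mul_le_of_le_one_left (norm_nonneg _) hA)
  · intro hA
    exact ContinuousLinearMap.opNorm_le_bound _ zero_le_one fun v => by
      simpa using hA v.ofLp

/-- `A Aᴴ ≤ 1` says that `Aᴴ`, hence `A`, is a contraction. -/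
theorem contractive_iff_one_sub_mul_conjTranspose_nonneg {n m : ℕ}
    (A : Matrix (Fin n) (Fin m) ℂ) :
    (∀ v : Fin m → ℂ, ∑ i, ‖A.mulVec v i‖ ^ 2 ≤ ∑ j, ‖v j‖ ^ 2) ↔
      ∀ c : Fin n → ℂ, 0 ≤ star c ⬝ᵥ ((1 - A * A.conjTranspose).mulVec c) := by
  rw [← l2_opNorm_le_one_iff, ← Matrix.l2_opNorm_conjTranspose, l2_opNorm_le_one_iff]
  refine forall_congr' fun c => ?_
  have hsq : ∀ {k : ℕ} (v : Fin k → ℂ), star v ⬝ᵥ v = ((∑ i, ‖v i‖ ^ 2 : ℝ) : ℂ) := by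
    intro k v
    push_cast
    refine Finset.sum_congr rfl fun i _ => ?_
    rw [Pi.star_apply, Complex.star_def, ← Complex.normSq_eq_conj_mul_self,
      Complex.normSq_eq_norm_sq]
    push_cast
    rfl
  have h : star c ⬝ᵥ ((1 - A * A.conjTranspose).mulVec c) =
      ((∑ j, ‖c j‖ ^ 2 - ∑ i, ‖A.conjTranspose.mulVec c i‖ ^ 2 : ℝ) : ℂ) := by
    rw [Complex.ofReal_sub, ← hsq, ← hsq, Matrix.sub_mulVec, Matrix.one_mulVec, dotProduct_sub,
      Matrix.star_mulVec, Matrix.conjTranspose_conjTranspose, ← Matrix.mulVec_mulVec,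
      Matrix.dotProduct_mulVec]
  rw [h, Complex.zero_le_real, sub_nonneg]

section Components

variable {n m : ℕ} {s : BC → Matrix (Fin n) (Fin m) BC}
  {S : Fin 2 → ℂ → Matrix (Fin n) (Fin m) ℂ}
  (hsS : ∀ Z ∈ bidisk, ∀ l i j, proj l (s Z i j) = S l (proj l Z) i j)

theorem proj_mulVec_apply {n m : ℕ} (l : Fin 2) (A : Matrix (Fin n) (Fin m) BC) (v : Fin m → BC)
    (i : Fin n) :
    proj l (A.mulVec v i) = (A.map (proj l)).mulVec (fun j => proj l (v j)) i := by
  simp [Matrix.mulVec, dotProduct]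

theorem proj_star_dotProduct_mulVec {n : ℕ} (l : Fin 2) (A : Matrix (Fin n) (Fin n) BC)
    (c d : Fin n → BC) :
    proj l (star c ⬝ᵥ A.mulVec d) = star (fun i => proj l (c i)) ⬝ᵥ
      (A.map (proj l)).mulVec (fun i => proj l (d i)) := by
  simp [dotProduct, proj_mulVec_apply]

/-- The diagonal embedding of a point of the disk in the bidisk. -/
theorem ofComplex_mem_bidisk {z : ℂ} (hz : z ∈ ball (0 : ℂ) 1) : ofComplex z ∈ bidisk :=
  mem_bidisk_iff_proj.2 fun l => by rwa [proj_ofComplex]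

include hsS

theorem map_proj_eq {Z : BC} (hZ : Z ∈ bidisk) (l : Fin 2) :
    (s Z).map (proj l) = S l (proj l Z) := by
  ext i j
  exact hsS Z hZ l i j

theorem map_proj_one_sub_mul {Z W : BC} (hZ : Z ∈ bidisk) (hW : W ∈ bidisk) (l : Fin 2) :
    (1 - s Z * (s W).conjTranspose).map (proj l) =
      1 - S l (proj l Z) * (S l (proj l W)).conjTranspose := by
  rw [← map_proj_eq hsS hZ, ← map_proj_eq hsS hW]
  ext i j
  simp [Matrix.mul_apply, Matrix.one_apply, apply_ite (proj l)]

/-- Condition 2 in idempotent components. -/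
theorem forall_bcMatrixLE_iff :
    (∀ Z ∈ bidisk, BCMatrixLE (s Z * (s Z).conjTranspose) 1) ↔
      ∀ l, ∀ z ∈ ball (0 : ℂ) 1, ∀ v : Fin m → ℂ,
        ∑ i, ‖(S l z).mulVec v i‖ ^ 2 ≤ ∑ j, ‖v j‖ ^ 2 := by
  simp only [contractive_iff_one_sub_mul_conjTranspose_nonneg]
  constructor
  · intro h l z hz c
    have h1 := (h _ (ofComplex_mem_bidisk hz)).2 fun i => ofComplex (c i)
    rw [mem_hypPos_iff_proj] at h1
    have h2 := h1 l
    rw [proj_star_dotProduct_mulVec, map_proj_one_sub_mul hsS (ofComplex_mem_bidisk hz)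
      (ofComplex_mem_bidisk hz)] at h2
    simpa only [proj_ofComplex] using h2
  · intro h Z hZ
    refine ⟨?_, fun c => mem_hypPos_iff_proj.2 fun l => ?_⟩
    · simp [Matrix.IsHermitian, Matrix.conjTranspose_sub, Matrix.conjTranspose_mul]
    · rw [proj_star_dotProduct_mulVec, map_proj_one_sub_mul hsS hZ hZ]
      exact h l _ (mem_bidisk_iff_proj.1 hZ l) _

/-- Positivity of the bicomplex kernel follows from that of its two components. -/
theorem isPosDefKernelOn_of_isSchurDisk (hS : ∀ l, IsSchurDisk (S l)) :
    IsPosDefKernelOn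
      (fun Z W => Ring.inverse (1 - Z * star W) • (1 - s Z * (s W).conjTranspose)) bidisk := by
  constructor
  · intro Z hZ W hW
    refine Matrix.ext fun i j => ext_proj fun l => ?_
    have h1 := map_proj_one_sub_mul hsS hZ hW l
    have h2 := map_proj_one_sub_mul hsS hW hZ l
    have h3 : proj l ((1 - s Z * (s W).conjTranspose : Matrix (Fin n) (Fin n) BC) i j) =
        star (proj l ((1 - s W * (s Z).conjTranspose : Matrix (Fin n) (Fin n) BC) j i)) := by
      have e1 := congrFun (congrFun h1 i) j
      have e2 := congrFun (congrFun h2 j) i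
      rw [Matrix.map_apply] at e1 e2
      rw [e1, e2, ← Matrix.conjTranspose_apply, Matrix.conjTranspose_sub, Matrix.conjTranspose_mul,
        Matrix.conjTranspose_conjTranspose, Matrix.conjTranspose_one]
    simp only [Matrix.smul_apply, Matrix.conjTranspose_apply, smul_eq_mul, star_mul', map_mul,
      proj_star, h3, proj_inverse (isUnit_one_sub_mul_star hZ hW),
      proj_inverse (isUnit_one_sub_mul_star hW hZ), star_inv₀, map_sub, map_one, star_sub, star_one,
      star_star]
    rw [mul_comm (star (proj l W))]
  · intro N c z hz
    refine mem_hypPos_iff_proj.2 fun l => ?_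
    have h := (hS l).kernel_nonneg c (fun j => proj l (z j))
      fun j => mem_bidisk_iff_proj.1 (hz j) l
    convert h using 1
    simp only [map_sum]
    refine Finset.sum_congr rfl fun p _ => Finset.sum_congr rfl fun q _ => ?_
    rw [proj_star_dotProduct_mulVec]
    simp only [proj_ofComplex]
    congr 2
    rw [← map_proj_one_sub_mul hsS (hz q) (hz p)]
    ext i j
    simp [proj_inverse (isUnit_one_sub_mul_star (hz q) (hz p))]

/-- The kernel on the diagonal, with a single test vector. -/
theorem contractive_of_isPosDefKernelOn
    (h : IsPosDefKernelOn
      (fun Z W => Ring.inverse (1 - Z * star W) • (1 - s Z * (s W).conjTranspose)) bidisk)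
    (l : Fin 2) {z : ℂ} (hz : z ∈ ball (0 : ℂ) 1) (v : Fin m → ℂ) :
    ∑ i, ‖(S l z).mulVec v i‖ ^ 2 ≤ ∑ j, ‖v j‖ ^ 2 := by
  refine (contractive_iff_one_sub_mul_conjTranspose_nonneg _).2 (fun c => ?_) v
  have hZ := ofComplex_mem_bidisk hz
  have h1 := h.2 1 (fun _ => c) (fun _ => ofComplex z) fun _ => hZ
  simp only [Finset.univ_unique, Finset.sum_singleton, Matrix.smul_mulVec, dotProduct_smul,
    smul_eq_mul] at h1
  have h2 := mem_hypPos_iff_proj.1 h1 l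
  rw [map_mul, proj_star_dotProduct_mulVec, map_proj_one_sub_mul hsS hZ hZ,
    proj_inverse (isUnit_one_sub_mul_star hZ hZ)] at h2
  simp only [proj_ofComplex, map_sub, map_one, map_mul, proj_star] at h2
  have h3 : (1 - z * star z) = ((1 - ‖z‖ ^ 2 : ℝ) : ℂ) := by
    rw [Complex.star_def, Complex.mul_conj, Complex.normSq_eq_norm_sq]
    push_cast
    rfl
  have h4 : 0 < 1 - ‖z‖ ^ 2 := by
    rw [mem_ball_zero_iff] at hz
    nlinarith [norm_nonneg z]
  have h5 : (0 : ℂ) ≤ ((1 - ‖z‖ ^ 2 : ℝ) : ℂ) := Complex.zero_le_real.2 h4.le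
  rw [h3] at h2
  have h6 := mul_nonneg h5 h2
  rwa [← mul_assoc, mul_inv_cancel₀ (Complex.ofReal_ne_zero.2 h4.ne'), one_mul] at h6

end Components

section Hardy

variable {n m : ℕ} {s : BC → Matrix (Fin n) (Fin m) BC}
  {S : Fin 2 → ℂ → Matrix (Fin n) (Fin m) ℂ}

theorem isHardyExpansion_hardyCoeff {f : BC → BC} (hf : MemHardy f) :
    IsHardyExpansion f (hardyCoeff f) := by
  rw [hardyCoeff, dif_pos hf]
  exact hf.choose_spec

theorem proj_mul_star_self (l : Fin 2) (Z : BC) :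
    proj l (Z * star Z) = ((‖proj l Z‖ ^ 2 : ℝ) : ℂ) := by
  rw [map_mul, proj_star, Complex.star_def, Complex.mul_conj, Complex.normSq_eq_norm_sq]

theorem summable_mul_star_iff {a : ℕ → BC} :
    Summable (fun k => a k * star (a k)) ↔ ∀ l, Summable fun k => ‖proj l (a k)‖ ^ 2 := by
  rw [summable_iff_proj]
  simp only [proj_mul_star_self, Complex.summable_ofReal]

theorem proj_hardyInnerVec_self {f : Fin m → BC → BC} (hf : ∀ j, MemHardy (f j)) (l : Fin 2) :
    proj l (hardyInnerVec f f) =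
      ((∑ j, ∑' k, ‖proj l (hardyCoeff (f j) k)‖ ^ 2 : ℝ) : ℂ) := by
  simp only [hardyInnerVec, hardyInner, map_sum]
  push_cast
  refine Finset.sum_congr rfl fun j _ => ?_
  rw [proj_tsum (isHardyExpansion_hardyCoeff (hf j)).1]
  simp only [proj_mul_star_self]
  push_cast
  rfl

/-- If `g` splits into functions of the idempotent coordinates with square summable Taylor
coefficients, it belongs to the bicomplex Hardy space. -/
theorem isHardyExpansion_ofProj {g : BC → BC} {φ : Fin 2 → ℂ → ℂ} {a : Fin 2 → ℕ → ℂ}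
    (ha : ∀ l, HasDiskExpansion (a l) (φ l)) (has : ∀ l, Summable fun k => ‖a l k‖ ^ 2)
    (hg : ∀ Z ∈ bidisk, ∀ l, proj l (g Z) = φ l (proj l Z)) :
    IsHardyExpansion g fun k => ofProj fun l => a l k := by
  refine ⟨summable_mul_star_iff.2 fun l => by simpa using has l, fun Z hZ => ?_⟩
  rw [hasSum_iff_proj]
  intro l
  rw [hg Z hZ l]
  simpa using ha l _ (mem_bidisk_iff_proj.1 hZ l)

/-- The components of a Hardy function, read off on the diagonal of the bidisk. -/
theorem hasDiskExpansion_of_isHardyExpansion {f : BC → BC} {a : ℕ → BC}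
    (h : IsHardyExpansion f a) (l : Fin 2) :
    HasDiskExpansion (fun k => proj l (a k)) fun z => proj l (f (ofComplex z)) := fun z hz => by
  simpa using hasSum_iff_proj.1 (h.2 _ (ofComplex_mem_bidisk hz)) l

/-- The values of a Hardy function in one idempotent coordinate depend on that coordinate only. -/
theorem proj_eq_of_isHardyExpansion {f : BC → BC} {a : ℕ → BC}
    (h : IsHardyExpansion f a) (l : Fin 2) {Z : BC} (hZ : Z ∈ bidisk) :
    proj l (f Z) = proj l (f (ofComplex (proj l Z))) := by
  have h1 := hasSum_iff_proj.1 (h.2 Z hZ) l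
  have h2 := hasDiskExpansion_of_isHardyExpansion h l _ (mem_bidisk_iff_proj.1 hZ l)
  simp only [map_mul, map_pow] at h1
  exact h1.unique h2

variable (hsS : ∀ Z ∈ bidisk, ∀ l i j, proj l (s Z i j) = S l (proj l Z) i j)
include hsS

theorem proj_mulFun {f : Fin m → BC → BC} {Z : BC} (hZ : Z ∈ bidisk) (l : Fin 2) (i : Fin n) :
    proj l (mulFun s f i Z) = (S l (proj l Z)).mulVec (fun j => proj l (f j Z)) i := by
  rw [mulFun, proj_mulVec_apply, map_proj_eq hsS hZ]

theorem isHardyContraction_of_isSchurDisk (hS : ∀ l, IsSchurDisk (S l)) :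
    IsHardyContraction s := by
  intro f hf
  have hfe := fun j l => hasDiskExpansion_of_isHardyExpansion (isHardyExpansion_hardyCoeff (hf j)) l
  have hfs := fun j => summable_mul_star_iff.1 (isHardyExpansion_hardyCoeff (hf j)).1
  have hmem : ∀ i, MemHardy (mulFun s f i) := by
    intro i
    choose b hb using fun l => (hS l).exists_expansion (fun j => hfe j l)
    refine ⟨_, isHardyExpansion_ofProj (a := fun l => b l i) (fun l => hb l i)
      (fun l => (HasDiskExpansion.sum_tsum_sq_le (fun j => hfe j l) (hb l) (fun j => hfs j l)
        fun z hz => (hS l).contractive z hz _).1 i) fun Z hZ l => ?_⟩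
    rw [proj_mulFun hsS hZ]
    simp only [fun j => proj_eq_of_isHardyExpansion (isHardyExpansion_hardyCoeff (hf j)) l hZ]
  refine ⟨hmem, hypLE_iff_proj.2 fun l => ?_⟩
  rw [proj_hardyInnerVec_self hmem, proj_hardyInnerVec_self hf, Complex.real_le_real]
  refine (HasDiskExpansion.sum_tsum_sq_le (fun j => hfe j l) (fun i =>
    hasDiskExpansion_of_isHardyExpansion (isHardyExpansion_hardyCoeff (hmem i)) l)
    (fun j => hfs j l) fun z hz => ?_).2
  simp only [proj_mulFun hsS (ofComplex_mem_bidisk hz), proj_ofComplex]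
  exact (hS l).contractive z hz _

/-- Apply the contraction to the reproducing kernel functions `v / (1 - Z w̄)` and use that point
evaluation at `w` has norm `(1 - |w|²)^{-1/2}`. -/
theorem contractive_of_isHardyContraction (h : IsHardyContraction s) (l : Fin 2) {w : ℂ}
    (hw : w ∈ ball (0 : ℂ) 1) (v : Fin m → ℂ) :
    ∑ i, ‖(S l w).mulVec v i‖ ^ 2 ≤ ∑ j, ‖v j‖ ^ 2 := by
  have hw' : star w ∈ ball (0 : ℂ) 1 := by simpa using hw
  have hpos : 0 < 1 - ‖w‖ ^ 2 := by
    rw [mem_ball_zero_iff] at hw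
    nlinarith [norm_nonneg w]
  set f : Fin m → BC → BC := fun j Z => ofProj fun l => v j * (1 - star w * proj l Z)⁻¹ with hf
  have hgeo : HasSum (fun k => ‖star w ^ k‖ ^ 2) (1 - ‖w‖ ^ 2)⁻¹ := by
    simp only [norm_pow, norm_star, ← pow_mul, mul_comm _ 2]
    simp only [pow_mul]
    exact hasSum_geometric_of_lt_one (sq_nonneg _) (by linarith)
  have hfe : ∀ j, IsHardyExpansion (f j) fun k => ofProj fun _ => v j * star w ^ k := fun j =>
    isHardyExpansion_ofProj (φ := fun _ z => v j * (1 - star w * z)⁻¹)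
      (fun l => (HasDiskExpansion.geometric hw').const_mul (v j))
      (fun l => by simpa only [norm_mul, mul_pow] using hgeo.summable.mul_left (‖v j‖ ^ 2))
      fun Z _ l => by rw [hf, proj_ofProj]
  have hfm : ∀ j, MemHardy (f j) := fun j => ⟨_, hfe j⟩
  obtain ⟨hgm, hle⟩ := h f hfm
  have hle' := hypLE_iff_proj.1 hle l
  rw [proj_hardyInnerVec_self hgm, proj_hardyInnerVec_self hfm, Complex.real_le_real] at hle'
  have hfnorm : ∀ j, ∑' k, ‖proj l (hardyCoeff (f j) k)‖ ^ 2 =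
      ‖v j‖ ^ 2 * (1 - ‖w‖ ^ 2)⁻¹ := by
    intro j
    have h1 := (hasDiskExpansion_of_isHardyExpansion
      (isHardyExpansion_hardyCoeff (hfm j)) l).unique
      (hasDiskExpansion_of_isHardyExpansion (hfe j) l)
    have h2 : ∀ k, proj l (hardyCoeff (f j) k) = v j * star w ^ k := fun k => by
      rw [← proj_ofProj (fun _ => v j * star w ^ k) l]
      exact congrFun h1 k
    simp only [h2, norm_mul, mul_pow]
    exact (hgeo.mul_left _).tsum_eq
  have hgval : ∀ i, ‖(S l w).mulVec v i‖ ^ 2 * ((1 - ‖w‖ ^ 2)⁻¹) ^ 2 ≤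
      (∑' k, ‖proj l (hardyCoeff (mulFun s f i) k)‖ ^ 2) * (1 - ‖w‖ ^ 2)⁻¹ := by
    intro i
    have hge := isHardyExpansion_hardyCoeff (hgm i)
    have h1 := (norm_tsum_mul_pow_sq_le (summable_mul_star_iff.1 hge.1 l) hw).2
    rw [(hasDiskExpansion_of_isHardyExpansion hge l w hw).tsum_eq] at h1
    dsimp only at h1
    rw [proj_mulFun hsS (ofComplex_mem_bidisk hw)] at h1
    have h2 : (fun j => proj l (f j (ofComplex w))) = (1 - star w * w)⁻¹ • v := by
      funext j
      simp [hf, mul_comm]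
    have h3 : 1 - star w * w = ((1 - ‖w‖ ^ 2 : ℝ) : ℂ) := by
      rw [Complex.star_def, ← Complex.normSq_eq_conj_mul_self, Complex.normSq_eq_norm_sq]
      push_cast
      rfl
    rw [h2, h3, proj_ofComplex, Matrix.mulVec_smul, Pi.smul_apply, norm_smul, mul_pow, norm_inv,
      Complex.norm_real, Real.norm_of_nonneg hpos.le, mul_comm] at h1
    exact h1
  have hsum := Finset.sum_le_sum fun i (_ : i ∈ Finset.univ) => hgval i
  simp only [← Finset.sum_mul] at hsum
  simp only [hfnorm, ← Finset.sum_mul] at hle'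
  have hfinal : (∑ i, ‖(S l w).mulVec v i‖ ^ 2) * ((1 - ‖w‖ ^ 2)⁻¹) ^ 2 ≤
      (∑ j, ‖v j‖ ^ 2) * ((1 - ‖w‖ ^ 2)⁻¹) ^ 2 := by
    refine hsum.trans ?_
    rw [sq (1 - ‖w‖ ^ 2)⁻¹, ← mul_assoc]
    exact mul_le_mul_of_nonneg_right hle' (inv_nonneg.2 hpos.le)
  exact le_of_mul_le_mul_right hfinal (by positivity)

theorem contractive_of_hasCoisometricRealization (h : HasCoisometricRealization.{u} s) (l : Fin 2)
    {z : ℂ} (hz : z ∈ ball (0 : ℂ) 1) (v : Fin m → ℂ) :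
    ∑ i, ‖(S l z).mulVec v i‖ ^ 2 ≤ ∑ j, ‖v j‖ ^ 2 := by
  have hZ := ofComplex_mem_bidisk hz
  have h1 := hypLE_iff_proj.1 (h.bcInner_mulVec_le hZ fun j => ofComplex (v j)) l
  have h2 : ∀ {k : ℕ} (x : Fin k → BC),
      proj l (bcInner x x) = ((∑ i, ‖proj l (x i)‖ ^ 2 : ℝ) : ℂ) := by
    intro k x
    change proj l (∑ i, x i * star (x i)) = _
    simp only [map_sum, proj_mul_star_self, Complex.ofReal_sum]
  rw [h2, h2, Complex.real_le_real] at h1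
  simpa only [proj_mulVec_apply, map_proj_eq hsS hZ, proj_ofComplex] using h1

end Hardy

end

theorem mainTheorem1 {n m : ℕ} (s : BC → Matrix (Fin n) (Fin m) BC)
    (hs : IsBCHolomorphicOn s BC.bidisk) :
    List.TFAE
      [ IsBCSchur s,
        ∀ Z ∈ BC.bidisk, BCMatrixLE (s Z * (s Z).conjTranspose) 1,
        IsPosDefKernelOn
          (fun Z W => Ring.inverse (1 - Z * star W) • (1 - s Z * (s W).conjTranspose)) BC.bidisk,
        IsHardyContraction s,
        HasCoisometricRealization.{u} s ] := by
  choose g hgd hg using fun l i j =>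
    exists_split_of_derivableAt (F := fun Z => s Z i j) (fun Z hZ => hs Z hZ i j) l
  set S : Fin 2 → ℂ → Matrix (Fin n) (Fin m) ℂ := fun l z => Matrix.of fun i j => g l i j z
  have hsS : ∀ Z ∈ bidisk, ∀ l i j, proj l (s Z i j) = S l (proj l Z) i j :=
    fun Z hZ l i j => hg l i j Z hZ
  have hSd : ∀ l i j, DifferentiableOn ℂ (fun z => S l z i j) (ball 0 1) := hgd
  have hSchur : (∀ l, ∀ z ∈ ball (0 : ℂ) 1, ∀ v : Fin m → ℂ,
      ∑ i, ‖(S l z).mulVec v i‖ ^ 2 ≤ ∑ j, ‖v j‖ ^ 2) → ∀ l, IsSchurDisk (S l) :=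
    fun h l => ⟨hSd l, h l⟩
  tfae_have 2 ↔ 1 := by
    rw [forall_bcMatrixLE_iff hsS]
    constructor
    · intro h
      refine ⟨hs, S 0, S 1, ⟨hSd 0, fun z hz => (l2_opNorm_le_one_iff _).2 (h 0 z hz)⟩,
        ⟨hSd 1, fun z hz => (l2_opNorm_le_one_iff _).2 (h 1 z hz)⟩, fun Z hZ i j => ?_⟩
      have h0 := hsS Z hZ 0 i j
      have h1 := hsS Z hZ 1 i j
      rw [proj_zero, proj_zero] at h0
      rw [proj_one, proj_one] at h1
      rw [← h0, ← h1]
      exact eq_idempotent _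
    · rintro ⟨-, s₁, s₂, h₁, h₂, h⟩ l z hz
      rw [← l2_opNorm_le_one_iff]
      have hZ := ofComplex_mem_bidisk hz
      have hSs : S l z = (![s₁, s₂] l) z := by
        ext i j
        have e1 := hsS _ hZ l i j
        have e2 := h _ hZ i j
        rw [proj_ofComplex] at e1
        rw [← e1, e2]
        fin_cases l
        · rw [← proj_zero, proj_ofComplex]
          exact β₁_idempotent _ _
        · rw [← proj_one, proj_ofComplex]
          exact β₂_idempotent _ _
      rw [hSs]
      fin_cases l
      · exact h₁.2 z hz
      · exact h₂.2 z hz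
  tfae_have 2 → 3 := fun h =>
    isPosDefKernelOn_of_isSchurDisk hsS (hSchur ((forall_bcMatrixLE_iff hsS).1 h))
  tfae_have 3 → 2 := fun h =>
    (forall_bcMatrixLE_iff hsS).2 fun l _ hz v => contractive_of_isPosDefKernelOn hsS h l hz v
  tfae_have 2 → 4 := fun h =>
    isHardyContraction_of_isSchurDisk hsS (hSchur ((forall_bcMatrixLE_iff hsS).1 h))
  tfae_have 4 → 2 := fun h =>
    (forall_bcMatrixLE_iff hsS).2 fun l _ hz v => contractive_of_isHardyContraction hsS h l hz v
  tfae_have 2 → 5 := fun h => hasCoisometricRealization_of_components hsS fun l =>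
    (hSchur ((forall_bcMatrixLE_iff hsS).1 h) l).nonempty_realization.some
  tfae_have 5 → 2 := fun h =>
    (forall_bcMatrixLE_iff hsS).2 fun l _ hz v =>
      contractive_of_hasCoisometricRealization hsS h l hz v
  tfae_finish
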